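/- Let $\mathbb U=\bigcup_{h\ge 0}\{1,2,\dots\}^h$ be the Ulam–Harris tree (finite words; the root is the empty word and the $i$-th child of a word $u$ is $ui$). A rooted subtree of $\mathbb U$ is a non-empty finite subset $\tau\subset\mathbb U$ such that $ui\in\tau$ implies $u\in\tau$ for all $u\in\mathbb U$ and $i\ge1$; let $\mathfrak t_n$ be the set of rooted subtrees with exactly $n$ vertices. For $i\ge 1$ let $N_i(\tau)$ be the number of vertices of $\tau$ of the form $vi$ with $v\in\mathbb U$. Theorem. Let $\theta=(\theta_1,\theta_2,\dots)$ be a sequence of non-negative real numbers with $0<\sum_{i\ge1}\theta_i<\infty$. For $n\ge1$ let $\mathbf{ST}_n^\theta$ be the probability distribution on $\mathfrak t_n$ given by $$\mathbf{ST}_n^\theta(\tau)=\frac{\prod_{i\ge1}\theta_i^{N_i(\tau)}}{\sum_{\tau'\in\mathfrak t_n}\prod_{i\ge1}\theta_i^{N_i(\tau')}},\qquad \tau\in\mathfrak t_n$$ (with $0^0=1$). Then there are a probability space and random variables $\mathcal T_n$, $n\ge1$, defined on it, with $\mathcal T_n$ taking values in $\mathfrak t_n$, such that $\mathcal T_n$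 has law $\mathbf{ST}_n^\theta$ for every $n\ge1$, the process $(\mathcal T_n)_{n\ge1}$ is Markov (the conditional law of $\mathcal T_{n+1}$ given $\mathcal T_1,\dots,\mathcal T_n$ is its conditional law given $\mathcal T_n$), and $\mathcal T_1\subset\mathcal T_2\subset\mathcal T_3\subset\cdots\subset\mathbb U$. -/

import Mathlib

open MeasureTheory ProbabilityTheory

/-- The vertex set of the Ulam–Harris tree: finite words on the alphabet `{1, 2, …}`. The empty
word is the root, and the `i`-th child of the word `u` is `u ++ [i]`. -/
abbrev UlamHarris : Type := List ℕ+

/-- A rooted subtree of the Ulam–Harris tree: a non-empty finite set of words that is closed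
under taking parents. -/
def IsRootedSubtree (τ : Finset UlamHarris) : Prop :=
  τ.Nonempty ∧ ∀ (u : UlamHarris) (i : ℕ+), u ++ [i] ∈ τ → u ∈ τ

/-- The set of rooted subtrees of the Ulam–Harris tree that have `n` vertices. -/
@[ext]
structure RootedSubtree (n : ℕ) where
  verts : Finset UlamHarris
  isRootedSubtree : IsRootedSubtree verts
  card_verts : verts.card = n

/-- Rooted subtrees carry the discrete σ-algebra. -/
instance RootedSubtree.instMeasurableSpace (n : ℕ) : MeasurableSpace (RootedSubtree n) := ⊤

open Classical in
/-- The set of vertices of type `i` in `τ`: those that are the `i`-th child of their parent. -/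
noncomputable def verticesOfType (i : ℕ+) (τ : Finset UlamHarris) : Finset UlamHarris :=
  τ.filter fun u => ∃ v : UlamHarris, u = v ++ [i]

/-- The weight `∏ i, θ i ^ N i τ`, where `N i τ` is the number of vertices of type `i` in `τ`
(all but finitely many factors are `1`). -/
noncomputable def subtreeWeight (θ : ℕ+ → ℝ) (τ : Finset UlamHarris) : ℝ :=
  ∏ᶠ i : ℕ+, θ i ^ (verticesOfType i τ).card

/-- The total weight of the rooted subtrees with `n` vertices, as a sum in `[0, ∞]`. -/
noncomputable def subtreePartition (θ : ℕ+ → ℝ) (n : ℕ) : ENNReal :=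
  ∑' τ : RootedSubtree n, ENNReal.ofReal (subtreeWeight θ τ.verts)

/-- The measure on rooted subtrees with `n` vertices that gives each `τ` the mass
`subtreeWeight θ τ / subtreePartition θ n`. -/
noncomputable def subtreeMeasure (θ : ℕ+ → ℝ) (n : ℕ) : Measure (RootedSubtree n) :=
  Measure.sum fun τ : RootedSubtree n =>
    (ENNReal.ofReal (subtreeWeight θ τ.verts) / subtreePartition θ n) • Measure.dirac τ

/-- The Markov property of a process indexed by `1, 2, …` whose value at time `n` lies in the
(countable, discrete) space `S n`: the conditional law of the next state given the past is its
conditional law given the present, for every past of positive probability. -/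
def IsMarkovProcess {Ω : Type*} [MeasurableSpace Ω] (P : Measure Ω) {S : ℕ+ → Type*}
    (X : (n : ℕ+) → Ω → S n) : Prop :=
  ∀ (n : ℕ+) (x : (k : ℕ+) → S k), P {ω | ∀ k ≤ n, X k ω = x k} ≠ 0 →
    P[{ω | X (n + 1) ω = x (n + 1)} | {ω | ∀ k ≤ n, X k ω = x k}]
      = P[{ω | X (n + 1) ω = x (n + 1)} | {ω | X n ω = x n}]

/-! The weight of a tree is the product over its vertices of the weights of their types, so the
generating function `T(x)` of the total weights `Z n`, `n ≥ 1`, solves `T = x f(T)` with `f(x) = ∏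
(1 + θ i x)`. A tree grows by a walk down from the root. At each vertex the types are examined in
order; for type `i` a coin, biased by the size `k` of that branch and the total size `m` of the
branches of later types, decides whether the new vertex goes there. The walk then continues inside
the chosen branch, which conditionally on its size is a weighted tree of the same kind.

The coins must carry the weights `a k * b m / S n` on `k + m = n` to those on `k + m = n + 1`, where
`a`, `b`, `S` are the coefficients of `1 + θ i T`, of `∏_{j > i} (1 + θ j T)` and of their product.
Conservation of mass determines the flow (`transportFlow`). It is admissible if `a (q+1) / a q` and
`b (q+1) / b q` are at most `S (n+1) / S n` for all `q ≤ n`.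

These bounds come from log-concavity of the coefficients of `f` and of its partial products
(`logConcaveSeq_tailEsymm`). It makes `[x^(n+1)] T^m / [x^n] T^m` non-decreasing in `m`
(`likelihoodRatioLE_lagrangeCoeff`), so series in `T` can be compared through the ratio of their
coefficients (`lagrangePair_mul_le`). Comparing a factor with the product settles `q = n`; comparing
`h` with `f(x) (h(x) - h(0)) / x` shows that `h(T)` has log-convex coefficients
(`lagrangePair_sq_le`), which settles `q < n`.

Induction over subtrees then shows that growth carries each law to the next
(`sum_growthProb_erase_div_lastWeight`). Some coin succeeds almost surely because the tails of `∑ θ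
i` vanish in the limit (`BranchSizes.tendsto_prod`). -/

/-! ### Log-concave sequences and the likelihood-ratio order -/

/-- Log-concavity without internal zeros, for non-negative sequences. -/
def LogConcaveSeq (h : ℕ → ℝ) : Prop :=
  ∀ a b k : ℕ, a ≤ b → h a * h (b + k) ≤ h (a + k) * h b

/-- `v / u` is non-decreasing. -/
def LikelihoodRatioLE (u v : ℕ → ℝ) : Prop :=
  ∀ m m' : ℕ, m < m' → u m' * v m ≤ u m * v m'

theorem logConcaveSeq_of_succ {h : ℕ → ℝ}
    (hh : ∀ a b : ℕ, a ≤ b → h a * h (b + 1) ≤ h (a + 1) * h b) : LogConcaveSeq h := by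
  intro a b k
  induction k generalizing a with
  | zero => intro _; simp
  | succ k ih =>
    intro hab
    rcases hab.eq_or_lt with rfl | hlt
    · exact (mul_comm _ _).le
    · calc h a * h (b + (k + 1)) = h a * h ((b + k) + 1) := by rw [add_assoc]
        _ ≤ h (a + 1) * h (b + k) := hh a (b + k) (by omega)
        _ ≤ h (a + 1 + k) * h b := ih (a + 1) hlt
        _ = h (a + (k + 1)) * h b := by rw [add_assoc, add_comm 1 k]

/-- On generating functions this is multiplication by `1 + t x`. The required inequality holds
separately for the coefficients of `1`, `t` and `t ^ 2`, each being log-concavity of `h` with shift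
1 or 2. -/
theorem LogConcaveSeq.mul_one_add {g h : ℕ → ℝ} {t : ℝ} (ht : 0 ≤ t)
    (hh : LogConcaveSeq h) (hpos : ∀ m, 0 ≤ h m) (g0 : g 0 = h 0)
    (gs : ∀ m, g (m + 1) = h (m + 1) + t * h m) : LogConcaveSeq g := by
  apply logConcaveSeq_of_succ
  intro a b hab
  rcases a with _ | a
  · rcases b with _ | b
    · exact (mul_comm _ _).le
    · rw [g0, gs, gs, gs]
      have h1 := hh 0 (b + 1) 1 (by omega)
      simp only [zero_add] at h1 ⊢
      nlinarith [mul_nonneg ht (mul_nonneg (hpos 1) (hpos b)),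
        mul_nonneg (mul_nonneg ht ht) (mul_nonneg (hpos 0) (hpos b))]
  · obtain ⟨b, rfl⟩ : ∃ c, b = c + 1 := ⟨b - 1, by omega⟩
    rw [gs, gs, gs, gs]
    have h1 := hh (a + 1) (b + 1) 1 hab
    have h2 := hh a b 1 (by omega)
    have h3 := hh a b 2 (by omega)
    have h2' := mul_le_mul_of_nonneg_left h2 (mul_nonneg ht ht)
    have h3' := mul_le_mul_of_nonneg_left h3 ht
    nlinarith

/-- Cauchy–Binet: twice the difference of the two sides is a double sum of products of two 2×2
minors, and in each product both minors have the same sign. -/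
theorem LikelihoodRatioLE.sum_mul_sum_le {u v φ ψ : ℕ → ℝ} (huv : LikelihoodRatioLE u v)
    (hφψ : LikelihoodRatioLE φ ψ) (s : Finset ℕ) :
    (∑ j ∈ s, u j * ψ j) * (∑ j ∈ s, v j * φ j) ≤
      (∑ j ∈ s, u j * φ j) * (∑ j ∈ s, v j * ψ j) := by
  have key : ∀ m m', 0 ≤ (u m * v m' - u m' * v m) * (φ m * ψ m' - φ m' * ψ m) := by
    intro m m'
    rcases lt_trichotomy m m' with h | rfl | h
    · exact mul_nonneg (sub_nonneg.2 (huv _ _ h)) (sub_nonneg.2 (hφψ _ _ h))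
    · simp
    · exact mul_nonneg_of_nonpos_of_nonpos (sub_nonpos.2 (huv _ _ h)) (sub_nonpos.2 (hφψ _ _ h))
  have h0 : 0 ≤ ∑ m ∈ s, ∑ m' ∈ s,
      (u m * v m' - u m' * v m) * (φ m * ψ m' - φ m' * ψ m) :=
    Finset.sum_nonneg fun m _ => Finset.sum_nonneg fun m' _ => key m m'
  have e : ∑ m ∈ s, ∑ m' ∈ s, (u m * v m' - u m' * v m) * (φ m * ψ m' - φ m' * ψ m) =
      (∑ j ∈ s, u j * φ j) * (∑ j ∈ s, v j * ψ j) - (∑ j ∈ s, u j * ψ j) * (∑ j ∈ s, v j * φ j)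
      - ((∑ j ∈ s, v j * φ j) * (∑ j ∈ s, u j * ψ j)
      - (∑ j ∈ s, v j * ψ j) * (∑ j ∈ s, u j * φ j)) := by
    simp only [Finset.sum_mul_sum, ← Finset.sum_sub_distrib]
    refine Finset.sum_congr rfl fun m _ => Finset.sum_congr rfl fun m' _ => ?_
    ring
  rw [e] at h0
  nlinarith

/-- The quotient of the convolution `h * c` by `h` is non-decreasing if `h` is log-concave. -/
theorem LogConcaveSeq.likelihoodRatioLE_mul {h : ℕ → ℝ} (hh : LogConcaveSeq h)
    (hpos : ∀ m, 0 ≤ h m) {c : PowerSeries ℝ} (hc : ∀ m, 0 ≤ PowerSeries.coeff m c)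
    {ψ : ℕ → ℝ} (hψ : ∀ m, ψ m = PowerSeries.coeff m (c * PowerSeries.mk h)) :
    LikelihoodRatioLE h ψ := by
  intro j j' hjj
  have hψ' : ∀ m, ψ m = ∑ k ∈ Finset.range (m + 1), PowerSeries.coeff k c * h (m - k) := by
    intro m
    rw [hψ, PowerSeries.coeff_mul, Finset.Nat.sum_antidiagonal_eq_sum_range_succ_mk]
    simp
  rw [hψ', hψ', Finset.mul_sum, Finset.mul_sum]
  calc ∑ k ∈ Finset.range (j + 1), h j' * (PowerSeries.coeff k c * h (j - k))
      ≤ ∑ k ∈ Finset.range (j + 1), h j * (PowerSeries.coeff k c * h (j' - k)) := by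
        -- Log-concavity with shift `k` compares the terms `k ≤ j`; the terms `j < k ≤ j'` only
        -- enlarge the right-hand side.
        refine Finset.sum_le_sum fun k hk => ?_
        have hk' : k ≤ j := by simpa [Nat.lt_succ_iff] using hk
        have := hh (j - k) (j' - k) k (by omega)
        rw [Nat.sub_add_cancel hk', Nat.sub_add_cancel (by omega)] at this
        nlinarith [mul_le_mul_of_nonneg_left this (hc k)]
    _ ≤ _ := Finset.sum_le_sum_of_subset_of_nonneg
        (fun x hx => by simp only [Finset.mem_range] at *; omega)
        fun k _ _ => mul_nonneg (hpos _) (mul_nonneg (hc k) (hpos _))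

/-! ### Elementary symmetric functions of the tails of a summable sequence -/

/-- The `m`-th elementary symmetric function of `t i, t (i + 1), …`. -/
noncomputable def tailEsymm (t : ℕ → ℝ) : ℕ → ℕ → ℝ
  | _, 0 => 1
  | i, m + 1 => ∑' j, t (i + j) * tailEsymm t (i + j + 1) m

section tailEsymm

variable {t : ℕ → ℝ}

@[simp] theorem tailEsymm_zero (i : ℕ) : tailEsymm t i 0 = 1 := by simp [tailEsymm]

theorem tailEsymm_nonneg (ht : ∀ i, 0 ≤ t i) (i m : ℕ) : 0 ≤ tailEsymm t i m := by
  induction m generalizing i with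
  | zero => simp
  | succ m ih =>
    rw [tailEsymm]
    exact tsum_nonneg fun j => mul_nonneg (ht _) (ih _)

theorem summable_comp_add_left (hs : Summable t) (i : ℕ) : Summable fun j => t (i + j) := by
  simpa [add_comm] using (summable_nat_add_iff i).2 hs

theorem tsum_comp_add_left_le (ht : ∀ i, 0 ≤ t i) (hs : Summable t) (i : ℕ) :
    ∑' j, t (i + j) ≤ ∑' j, t j :=
  tsum_comp_le_tsum_of_inj hs ht (add_right_injective i)

theorem tailEsymm_le (ht : ∀ i, 0 ≤ t i) (hs : Summable t) (i m : ℕ) :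
    tailEsymm t i m ≤ (∑' j, t j) ^ m := by
  induction m generalizing i with
  | zero => simp
  | succ m ih =>
    have hS := summable_comp_add_left hs i
    have h0 : 0 ≤ ∑' j, t j := tsum_nonneg ht
    have hle : ∀ j, t (i + j) * tailEsymm t (i + j + 1) m ≤ t (i + j) * (∑' j, t j) ^ m :=
      fun j => mul_le_mul_of_nonneg_left (ih _) (ht _)
    rw [tailEsymm]
    calc _ ≤ ∑' j, t (i + j) * (∑' j, t j) ^ m :=
          (Summable.of_nonneg_of_le (fun j => mul_nonneg (ht _) (tailEsymm_nonneg ht _ _)) hle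
            (hS.mul_right _)).tsum_le_tsum hle (hS.mul_right _)
      _ = (∑' j, t (i + j)) * (∑' j, t j) ^ m := tsum_mul_right
      _ ≤ _ := by
        rw [pow_succ, mul_comm]
        exact mul_le_mul_of_nonneg_left (tsum_comp_add_left_le ht hs i) (pow_nonneg h0 m)

theorem summable_tailEsymm (ht : ∀ i, 0 ≤ t i) (hs : Summable t) (i m : ℕ) :
    Summable fun j => t (i + j) * tailEsymm t (i + j + 1) m :=
  Summable.of_nonneg_of_le (fun _ => mul_nonneg (ht _) (tailEsymm_nonneg ht _ _))
    (fun _ => mul_le_mul_of_nonneg_left (tailEsymm_le ht hs _ _) (ht _))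
    ((summable_comp_add_left hs i).mul_right _)

theorem tailEsymm_succ (ht : ∀ i, 0 ≤ t i) (hs : Summable t) (i m : ℕ) :
    tailEsymm t i (m + 1) = tailEsymm t (i + 1) (m + 1) + t i * tailEsymm t (i + 1) m := by
  rw [tailEsymm, (summable_tailEsymm ht hs i m).tsum_eq_zero_add, tailEsymm, add_comm]
  simp only [add_zero]
  congr 1
  refine tsum_congr fun j => ?_
  rw [show i + (j + 1) = i + 1 + j by ring]

/-- Dominated convergence. This reduces log-concavity, a closed condition, to finitely many non-zero
weights. -/
theorem tendsto_tailEsymm_truncate (ht : ∀ i, 0 ≤ t i) (hs : Summable t) (i m : ℕ) :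
    Filter.Tendsto (fun N : ℕ => tailEsymm (fun j => if j < N then t j else 0) i m)
      Filter.atTop (nhds (tailEsymm t i m)) := by
  induction m generalizing i with
  | zero => simp
  | succ m ih =>
    simp only [tailEsymm]
    have ht' : ∀ N i, 0 ≤ (if i < N then t i else 0) := fun N i => by split_ifs <;> simp [ht]
    have hle : ∀ N i, (if i < N then t i else 0) ≤ t i := fun N i => by split_ifs <;> simp [ht]
    have hs' : ∀ N, Summable fun i => (if i < N then t i else 0) := fun N =>
      Summable.of_nonneg_of_le (ht' N) (hle N) hs
    refine tendsto_tsum_of_dominated_convergence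
      (bound := fun j => t (i + j) * (∑' j, t j) ^ m)
      ((summable_comp_add_left hs i).mul_right _) (fun j => ?_) (.of_forall fun N j => ?_)
    · refine Filter.Tendsto.mul ?_ (ih _)
      refine tendsto_const_nhds.congr' ?_
      filter_upwards [Filter.eventually_gt_atTop (i + j)] with N hN
      simp [hN]
    · have e0 := tailEsymm_nonneg (ht' N) (i + j + 1) m
      rw [Real.norm_of_nonneg (mul_nonneg (ht' N _) e0)]
      refine mul_le_mul (hle N _) ?_ e0 (ht _)
      refine (tailEsymm_le (ht' N) (hs' N) _ _).trans ?_
      exact pow_le_pow_left₀ (tsum_nonneg (ht' N)) ((hs' N).tsum_le_tsum (hle N) hs) _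

/-- Downward induction from an index past the last non-zero weight, where the series is `1`,
multiplying by one factor `1 + t i x` at a time. -/
theorem logConcaveSeq_tailEsymm_of_eventually_zero (ht : ∀ i, 0 ≤ t i) (hs : Summable t) {N : ℕ}
    (hN : ∀ j, N ≤ j → t j = 0) (k i : ℕ) (hk : N ≤ i + k) : LogConcaveSeq (tailEsymm t i) := by
  induction k generalizing i with
  | zero =>
    have : ∀ m, tailEsymm t i (m + 1) = 0 := fun m => by
      rw [tailEsymm]
      simp [fun j => hN (i + j) (by omega)]
    apply logConcaveSeq_of_succ
    intro a b _
    rw [this, this]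
    simp
  | succ k ih =>
    exact (ih (i + 1) (by omega)).mul_one_add (ht i) (tailEsymm_nonneg ht _) (by simp)
      (tailEsymm_succ ht hs i)

theorem logConcaveSeq_tailEsymm (ht : ∀ i, 0 ≤ t i) (hs : Summable t) (i : ℕ) :
    LogConcaveSeq (tailEsymm t i) := by
  intro a b k hab
  have T := fun m => tendsto_tailEsymm_truncate ht hs i m
  have ht' : ∀ N i, 0 ≤ (if i < N then t i else 0) := fun N i => by split_ifs <;> simp [ht]
  refine le_of_tendsto_of_tendsto' ((T a).mul (T (b + k))) ((T (a + k)).mul (T b)) fun N => ?_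
  refine logConcaveSeq_tailEsymm_of_eventually_zero (ht' N) ?_ (N := N) ?_ N i (by omega) a b k hab
  · exact Summable.of_nonneg_of_le (ht' N) (fun i => by split_ifs <;> simp [ht]) hs
  · intro j hj
    simp [hj]

theorem mk_tailEsymm_eq (ht : ∀ i, 0 ≤ t i) (hs : Summable t) (i : ℕ) :
    PowerSeries.mk (tailEsymm t i) =
      (1 + PowerSeries.C (t i) * PowerSeries.X) * PowerSeries.mk (tailEsymm t (i + 1)) := by
  ext m
  rw [add_mul, one_mul, map_add, mul_assoc, PowerSeries.coeff_C_mul]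
  rcases m with _ | m
  · simp
  · rw [PowerSeries.coeff_succ_X_mul]
    simpa using tailEsymm_succ ht hs i m

theorem coeff_mul_nonneg {f g : PowerSeries ℝ} (hf : ∀ m, 0 ≤ PowerSeries.coeff m f)
    (hg : ∀ m, 0 ≤ PowerSeries.coeff m g) (m : ℕ) : 0 ≤ PowerSeries.coeff m (f * g) := by
  rw [PowerSeries.coeff_mul]
  exact Finset.sum_nonneg fun p _ => mul_nonneg (hf _) (hg _)

theorem coeff_one_add_C_mul_X_nonneg {a : ℝ} (ha : 0 ≤ a) (m : ℕ) :
    0 ≤ PowerSeries.coeff m (1 + PowerSeries.C a * PowerSeries.X) := by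
  rw [map_add, PowerSeries.coeff_C_mul, PowerSeries.coeff_one, PowerSeries.coeff_X]
  split_ifs <;> first | omega | simp [ha]

/-- `G` is the finite product of the factors `1 + t j x` with `j < i`. -/
theorem exists_mk_tailEsymm_zero_eq (ht : ∀ i, 0 ≤ t i) (hs : Summable t) (i : ℕ) :
    ∃ G : PowerSeries ℝ, (∀ m, 0 ≤ PowerSeries.coeff m G) ∧
      PowerSeries.mk (tailEsymm t 0) = G * PowerSeries.mk (tailEsymm t i) := by
  induction i with
  | zero =>
    refine ⟨1, fun m => ?_, by simp⟩
    rw [PowerSeries.coeff_one]; split_ifs <;> simp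
  | succ i ih =>
    obtain ⟨G, hG, h⟩ := ih
    refine ⟨G * (1 + PowerSeries.C (t i) * PowerSeries.X),
      coeff_mul_nonneg hG (coeff_one_add_C_mul_X_nonneg (ht i)), ?_⟩
    rw [h, mk_tailEsymm_eq ht hs i, mul_assoc]

theorem tailEsymm_one (i : ℕ) : tailEsymm t i 1 = ∑' j, t (i + j) := by
  simp [tailEsymm]

end tailEsymm

/-! ### Coefficients of the powers of the solution of `T = x f(T)` -/

/-- The coefficient of `x ^ n` in `T ^ m`, where `T = x f(T)` and `f = ∑ e k x ^ k`. -/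
noncomputable def lagrangeCoeff (e : ℕ → ℝ) : ℕ → ℕ → ℝ
  | 0, m => if m = 0 then 1 else 0
  | _ + 1, 0 => 0
  | n + 1, m + 1 => ∑ k ∈ Finset.range (n + 1), e k * lagrangeCoeff e n (m + k)

section lagrangeCoeff

variable {e : ℕ → ℝ}

@[simp] theorem lagrangeCoeff_zero_zero : lagrangeCoeff e 0 0 = 1 := by simp [lagrangeCoeff]

@[simp] theorem lagrangeCoeff_zero_succ (m : ℕ) : lagrangeCoeff e 0 (m + 1) = 0 := by
  simp [lagrangeCoeff]

@[simp] theorem lagrangeCoeff_succ_zero (n : ℕ) : lagrangeCoeff e (n + 1) 0 = 0 := by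
  simp [lagrangeCoeff]

theorem lagrangeCoeff_nonneg (he : ∀ k, 0 ≤ e k) (n m : ℕ) : 0 ≤ lagrangeCoeff e n m := by
  induction n generalizing m with
  | zero => rw [lagrangeCoeff]; split_ifs <;> simp
  | succ n ih =>
    rcases m with _ | m
    · simp
    · rw [lagrangeCoeff]
      exact Finset.sum_nonneg fun k _ => mul_nonneg (he k) (ih _)

theorem lagrangeCoeff_eq_zero {n m : ℕ} (h : n < m) : lagrangeCoeff e n m = 0 := by
  induction n generalizing m with
  | zero => rw [lagrangeCoeff, if_neg (by omega)]
  | succ n ih =>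
    obtain ⟨m, rfl⟩ : ∃ c, m = c + 1 := ⟨m - 1, by omega⟩
    rw [lagrangeCoeff]
    exact Finset.sum_eq_zero fun k _ => by rw [ih (by omega), mul_zero]

/-- The coefficient of `x ^ n` in `∑ φ j T ^ j`. -/
noncomputable def lagrangePair (e φ : ℕ → ℝ) (n : ℕ) : ℝ :=
  ∑ j ∈ Finset.range (n + 1), lagrangeCoeff e n j * φ j

theorem lagrangePair_eq_sum (φ : ℕ → ℝ) {n M : ℕ} (h : n < M) :
    lagrangePair e φ n = ∑ j ∈ Finset.range M, lagrangeCoeff e n j * φ j := by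
  refine Finset.sum_subset (fun j hj => ?_) fun j _ hj => ?_
  · simp only [Finset.mem_range] at *; omega
  · rw [lagrangeCoeff_eq_zero (by simpa using hj), zero_mul]

theorem lagrangePair_nonneg (he : ∀ k, 0 ≤ e k) {φ : ℕ → ℝ} (hφ : ∀ k, 0 ≤ φ k) (n : ℕ) :
    0 ≤ lagrangePair e φ n :=
  Finset.sum_nonneg fun _ _ => mul_nonneg (lagrangeCoeff_nonneg he _ _) (hφ _)

/-- This is `T^(m+1) = x T^m f(T)`; the form as a pairing makes `sum_mul_sum_le` applicable. -/
theorem lagrangeCoeff_succ_succ (n m : ℕ) :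
    lagrangeCoeff e (n + 1) (m + 1) =
      lagrangePair e (fun j => if m ≤ j then e (j - m) else 0) n := by
  rw [lagrangePair_eq_sum _ (show n < m + (n + 1) by omega), Finset.sum_range_add,
    Finset.sum_eq_zero (s := Finset.range m), zero_add, lagrangeCoeff]
  · refine Finset.sum_congr rfl fun k _ => ?_
    simp [mul_comm]
  · intro j hj
    simp only [Finset.mem_range] at hj
    rw [if_neg (by omega), mul_zero]

/-- `T^(m+m') = T^m T^m'`, which the linear recursion for the coefficients does not make evident; it
lets single trees be split off from forests. -/
theorem lagrangeCoeff_add (n m m' : ℕ) :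
    lagrangeCoeff e n (m + m') =
      ∑ p ∈ Finset.HasAntidiagonal.antidiagonal n, lagrangeCoeff e p.1 m * lagrangeCoeff e p.2 m' := by
  have hext : ∀ n m M, n < M → lagrangeCoeff e (n + 1) (m + 1) =
      ∑ k ∈ Finset.range M, e k * lagrangeCoeff e n (m + k) := fun n m M h => by
    rw [lagrangeCoeff]
    refine Finset.sum_subset (fun j hj => ?_) fun j _ hj => ?_
    · simp only [Finset.mem_range] at *; omega
    · rw [lagrangeCoeff_eq_zero, mul_zero]
      simp only [Finset.mem_range] at hj; omega
  induction n generalizing m with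
  | zero => rcases m with _ | m <;> simp [Nat.succ_add]
  | succ n ih =>
    rw [Finset.Nat.antidiagonal_succ, Finset.sum_cons, Finset.sum_map]
    rcases m with _ | m
    · simp
    · rw [show m + 1 + m' = m + m' + 1 by ring, hext n _ (n + 1) (by omega)]
      simp only [lagrangeCoeff_zero_succ, zero_mul, zero_add, Function.Embedding.prodMap,
        Function.Embedding.coeFn_mk, Prod.map, Function.Embedding.refl_apply, Nat.succ_eq_add_one]
      have h : ∀ p ∈ Finset.HasAntidiagonal.antidiagonal n,
          lagrangeCoeff e (p.1 + 1) (m + 1) * lagrangeCoeff e p.2 m' =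
            ∑ k ∈ Finset.range (n + 1),
              e k * lagrangeCoeff e p.1 (m + k) * lagrangeCoeff e p.2 m' := fun p hp => by
        rw [hext p.1 m (n + 1)
          (by have := Finset.HasAntidiagonal.mem_antidiagonal.1 hp; omega), Finset.sum_mul]
      rw [Finset.sum_congr rfl h, Finset.sum_comm]
      refine Finset.sum_congr rfl fun k _ => ?_
      rw [show m + m' + k = m + k + m' by ring, ih, Finset.mul_sum]
      exact Finset.sum_congr rfl fun p _ => by ring

theorem likelihoodRatioLE_shift (he : ∀ k, 0 ≤ e k) (hlc : LogConcaveSeq e) {m m' : ℕ}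
    (h : m < m') : LikelihoodRatioLE (fun j => if m ≤ j then e (j - m) else 0)
      (fun j => if m' ≤ j then e (j - m') else 0) := by
  intro j j' hjj
  by_cases h1 : m' ≤ j
  · have := hlc (j - m') (j' - m') (m' - m) (by omega)
    simp only [if_pos h1, if_pos (show m ≤ j by omega), if_pos (show m' ≤ j' by omega),
      if_pos (show m ≤ j' by omega)]
    rw [show j' - m = j' - m' + (m' - m) by omega, show j - m = j - m' + (m' - m) by omega]
    linarith
  · simp only [if_neg h1, mul_zero]
    apply mul_nonneg <;> split_ifs <;> simp [he]

/-- Induction on `n`: passing from `n` to `n + 1` pairs the coefficients with shifts of `e`, and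
log-concavity of `e` says that these shifts are ordered by likelihood ratio. -/
theorem likelihoodRatioLE_lagrangeCoeff (he : ∀ k, 0 ≤ e k) (hlc : LogConcaveSeq e) (n : ℕ) :
    LikelihoodRatioLE (lagrangeCoeff e n) (lagrangeCoeff e (n + 1)) := by
  induction n with
  | zero =>
    intro m m' h
    obtain ⟨c, rfl⟩ : ∃ c, m' = c + 1 := ⟨m' - 1, by omega⟩
    rw [lagrangeCoeff_zero_succ, zero_mul]
    exact mul_nonneg (lagrangeCoeff_nonneg he _ _) (lagrangeCoeff_nonneg he _ _)
  | succ n ih =>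
    intro m m' h
    obtain ⟨m', rfl⟩ : ∃ c, m' = c + 1 := ⟨m' - 1, by omega⟩
    rcases m with _ | m
    · simp
    · simp only [lagrangeCoeff_succ_succ]
      rw [lagrangePair_eq_sum (n := n) _ (show n < n + 2 by omega),
        lagrangePair_eq_sum (n := n) _ (show n < n + 2 by omega)]
      exact ih.sum_mul_sum_le (likelihoodRatioLE_shift he hlc (by omega)) _

theorem lagrangePair_mul_le (he : ∀ k, 0 ≤ e k) (hlc : LogConcaveSeq e) {φ ψ : ℕ → ℝ}
    (h : LikelihoodRatioLE φ ψ) (n : ℕ) :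
    lagrangePair e ψ n * lagrangePair e φ (n + 1) ≤
      lagrangePair e φ n * lagrangePair e ψ (n + 1) := by
  rw [lagrangePair_eq_sum (n := n) _ (show n < n + 2 by omega),
    lagrangePair_eq_sum (n := n) _ (show n < n + 2 by omega)]
  exact (likelihoodRatioLE_lagrangeCoeff he hlc n).sum_mul_sum_le h _

/-- With `g(x) = (h(x) - h(0)) / x`, one has `h(T) - h(0) = T g(T) = x f(T) g(T)`. -/
theorem lagrangePair_succ (h : ℕ → ℝ) (n : ℕ) :
    lagrangePair e h (n + 1) = lagrangePair e (fun j =>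
      PowerSeries.coeff j (PowerSeries.mk e * PowerSeries.mk fun m => h (m + 1))) n := by
  rw [lagrangePair, Finset.sum_range_succ', lagrangeCoeff_succ_zero, zero_mul, add_zero]
  simp only [lagrangeCoeff_succ_succ, lagrangePair, Finset.sum_mul]
  rw [Finset.sum_comm]
  refine Finset.sum_congr rfl fun j hj => ?_
  rw [mul_comm (PowerSeries.mk e), PowerSeries.coeff_mul,
    Finset.Nat.sum_antidiagonal_eq_sum_range_succ_mk, Finset.mul_sum]
  symm
  refine Finset.sum_subset_zero_on_sdiff (fun k hk => ?_) (fun k hk => ?_) fun k hk => ?_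
  · simp only [Finset.mem_range] at *; omega
  · simp only [Finset.mem_sdiff, Finset.mem_range] at hk
    rw [if_neg (by omega)]; simp
  · simp only [Finset.mem_range] at hk
    rw [if_pos (by omega)]
    simp only [PowerSeries.coeff_mk]
    ring

/-- If `h` is a log-concave factor of `e`, then the coefficients of `h(T)` are log-convex. -/
theorem lagrangePair_sq_le (he : ∀ k, 0 ≤ e k) (hlc : LogConcaveSeq e) {h : ℕ → ℝ}
    (hpos : ∀ m, 0 ≤ h m) (hh : LogConcaveSeq h) {G : PowerSeries ℝ}
    (hG : ∀ m, 0 ≤ PowerSeries.coeff m G)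
    (hfac : PowerSeries.mk e = G * PowerSeries.mk h) (n : ℕ) :
    lagrangePair e h (n + 1) * lagrangePair e h (n + 1) ≤
      lagrangePair e h n * lagrangePair e h (n + 2) := by
  have hLR : LikelihoodRatioLE h fun j =>
      PowerSeries.coeff j (PowerSeries.mk e * PowerSeries.mk fun m => h (m + 1)) := by
    refine hh.likelihoodRatioLE_mul hpos
      (c := G * PowerSeries.mk fun m => h (m + 1)) ?_ fun m => ?_
    · exact coeff_mul_nonneg hG fun m => by simp [hpos]
    · rw [hfac]; congr 1; ring
  -- By `lagrangePair_succ` the larger series in this comparison is `h(T)` with its index moved by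
  -- one, so the comparison is log-convexity.
  have := lagrangePair_mul_le he hlc hLR n
  rw [← lagrangePair_succ, ← lagrangePair_succ] at this
  exact this

end lagrangeCoeff

/-! ### Monotone transport between consecutive convolution laws -/

/-- The ratios `b (m + 1) / b m` are non-decreasing, so a bound at `n` propagates downwards. -/
theorem ratio_le_of_logConvex {b S : ℕ → ℝ} (hb : ∀ n, 0 ≤ b n) (hS : ∀ n, 0 ≤ S n)
    (hlc : ∀ n, b (n + 1) * b (n + 1) ≤ b n * b (n + 2)) {n : ℕ}
    (h : b (n + 1) * S n ≤ b n * S (n + 1)) (m : ℕ) (hm : m ≤ n) :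
    b (m + 1) * S n ≤ b m * S (n + 1) := by
  induction hm using Nat.decreasingInduction with
  | self => exact h
  | of_succ m hm ih =>
    rcases (hb (m + 1)).eq_or_lt with h0 | h0
    · rw [← h0, zero_mul]
      exact mul_nonneg (hb _) (hS _)
    · refine le_of_mul_le_mul_left ?_ h0
      calc b (m + 1) * (b (m + 1) * S n) = b (m + 1) * b (m + 1) * S n := by ring
        _ ≤ b m * b (m + 2) * S n := mul_le_mul_of_nonneg_right (hlc m) (hS _)
        _ = b m * (b (m + 2) * S n) := by ring
        _ ≤ b m * (b (m + 1) * S (n + 1)) := mul_le_mul_of_nonneg_left ih (hb _)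
        _ = _ := by ring

/-- The mass that has to move from `(k, m)` to `(k + 1, m)` when the weights `a k * b m` on
`k + m = n` are transported to those on `k + m = n + 1`, the latter being multiplied by `r`. -/
noncomputable def transportFlow (a b : ℕ → ℝ) (r : ℝ) (k m : ℕ) : ℝ :=
  ∑ l ∈ Finset.range (k + 1), a l * (b (k + m - l) - b (k + m + 1 - l) * r)

/-- The flow is a difference of two distribution functions in the first coordinate. As `r` equates
the total masses, the mass of `(k, m)` that does not move in the first coordinate is the flow for
the exchanged roles. -/
theorem transportFlow_add_swap (a b : ℕ → ℝ) (r : ℝ) (k m : ℕ)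
    (hr : ∑ l ∈ Finset.range (k + m + 1), a l * b (k + m - l) =
      r * ∑ l ∈ Finset.range (k + m + 2), a l * b (k + m + 1 - l)) :
    transportFlow a b r k m + transportFlow b a r m k = a k * b m := by
  have e1 : ∑ l ∈ Finset.range (k + m + 1), a l * b (k + m - l) =
      ∑ l ∈ Finset.range (k + 1), a l * b (k + m - l) +
        ∑ q ∈ Finset.range m, b q * a (k + m - q) := by
    rw [show k + m + 1 = k + 1 + m by ring, Finset.sum_range_add]
    congr 1
    rw [← Finset.sum_range_reflect]
    refine Finset.sum_congr rfl fun q hq => ?_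
    simp only [Finset.mem_range] at hq
    rw [mul_comm]
    congr 2 <;> omega
  have e2 : ∑ l ∈ Finset.range (k + m + 2), a l * b (k + m + 1 - l) =
      ∑ l ∈ Finset.range (k + 1), a l * b (k + m + 1 - l) +
        ∑ q ∈ Finset.range (m + 1), b q * a (k + m + 1 - q) := by
    rw [show k + m + 2 = k + 1 + (m + 1) by ring, Finset.sum_range_add]
    congr 1
    rw [← Finset.sum_range_reflect]
    refine Finset.sum_congr rfl fun q hq => ?_
    simp only [Finset.mem_range] at hq
    rw [mul_comm]
    congr 2 <;> omega
  have e3 : ∑ q ∈ Finset.range (m + 1), b q * a (k + m - q) =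
      ∑ q ∈ Finset.range m, b q * a (k + m - q) + b m * a k := by
    rw [Finset.sum_range_succ, Nat.add_sub_cancel]
  have f1 : transportFlow a b r k m = ∑ l ∈ Finset.range (k + 1), a l * b (k + m - l) -
      r * ∑ l ∈ Finset.range (k + 1), a l * b (k + m + 1 - l) := by
    rw [transportFlow, Finset.mul_sum, ← Finset.sum_sub_distrib]
    exact Finset.sum_congr rfl fun l _ => by ring
  have f2 : transportFlow b a r m k = ∑ l ∈ Finset.range (m + 1), b l * a (k + m - l) -
      r * ∑ l ∈ Finset.range (m + 1), b l * a (k + m + 1 - l) := by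
    rw [transportFlow, Finset.mul_sum, ← Finset.sum_sub_distrib, add_comm m k]
    exact Finset.sum_congr rfl fun l _ => by ring
  rw [e1, e2] at hr
  rw [f1, f2, e3]
  linarith

theorem transportFlow_nonneg {a b : ℕ → ℝ} {r : ℝ} {k m : ℕ} (ha : ∀ n, 0 ≤ a n)
    (h : ∀ q, q ≤ k + m → b (q + 1) * r ≤ b q) : 0 ≤ transportFlow a b r k m := by
  refine Finset.sum_nonneg fun l hl => mul_nonneg (ha l) (sub_nonneg.2 ?_)
  simp only [Finset.mem_range] at hl
  rw [show k + m + 1 - l = k + m - l + 1 by omega]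
  exact h _ (by omega)

theorem transportFlow_succ (a b : ℕ → ℝ) (r : ℝ) (k m : ℕ) :
    transportFlow a b r (k + 1) m =
      transportFlow a b r k (m + 1) + a (k + 1) * (b m - b (m + 1) * r) := by
  rw [transportFlow, Finset.sum_range_succ, transportFlow]
  congr 1
  · rw [show k + (m + 1) = k + 1 + m by ring]
  · congr 3
    · omega
    · congr 1; omega

/-! ### Weights of trees and forests of given size -/

/-- The total weight of the trees with `n` vertices (and `1` for `n = 0`). -/
noncomputable def treeWeight (t : ℕ → ℝ) (n : ℕ) : ℝ :=
  if n = 0 then 1 else lagrangeCoeff (tailEsymm t 0) n 1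

/-- The total weight of the possibly empty trees with `n` vertices attached by an edge of
type `i`. -/
noncomputable def branchWeight (t : ℕ → ℝ) (i n : ℕ) : ℝ :=
  if n = 0 then 1 else t i * treeWeight t n

/-- The total weight of the forests with `n` vertices attached by edges of types `≥ i`. -/
noncomputable def forestWeight (t : ℕ → ℝ) (i n : ℕ) : ℝ :=
  lagrangePair (tailEsymm t 0) (tailEsymm t i) n

section weights

variable {t : ℕ → ℝ}

theorem forestWeight_zero_left (n : ℕ) : forestWeight t 0 n = treeWeight t (n + 1) := by
  simp [treeWeight, forestWeight, lagrangeCoeff_succ_succ n 0]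

@[simp] theorem treeWeight_zero : treeWeight t 0 = 1 := by simp [treeWeight]

@[simp] theorem branchWeight_zero (i : ℕ) : branchWeight t i 0 = 1 := by simp [branchWeight]

@[simp] theorem forestWeight_zero (i : ℕ) : forestWeight t i 0 = 1 := by
  simp [forestWeight, lagrangePair]

@[simp] theorem treeWeight_one : treeWeight t 1 = 1 := by
  rw [← forestWeight_zero_left, forestWeight_zero]

theorem forestWeight_one (i : ℕ) : forestWeight t i 1 = ∑' j, t (i + j) := by
  have : lagrangeCoeff (tailEsymm t 0) 1 1 = 1 := by
    simpa [treeWeight] using treeWeight_one (t := t)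
  simp [forestWeight, lagrangePair, Finset.sum_range_succ, this, tailEsymm_one]

theorem forestWeight_nonneg (ht : ∀ i, 0 ≤ t i) (i n : ℕ) : 0 ≤ forestWeight t i n :=
  lagrangePair_nonneg (tailEsymm_nonneg ht 0) (tailEsymm_nonneg ht i) n

theorem treeWeight_pos (ht : ∀ i, 0 ≤ t i) (hpos : 0 < ∑' i, t i) (n : ℕ) :
    0 < treeWeight t n := by
  rcases n with _ | n
  · simp
  induction n with
  | zero => simp
  | succ n ih =>
    rw [← forestWeight_zero_left, forestWeight, lagrangePair]
    refine lt_of_lt_of_le ?_ (Finset.single_le_sum (f := fun j => _ * _) (fun j _ => mul_nonneg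
      (lagrangeCoeff_nonneg (tailEsymm_nonneg ht 0) _ j) (tailEsymm_nonneg ht 0 j))
      (show 1 ∈ Finset.range (n + 1 + 1) by simp))
    refine mul_pos (by simpa [treeWeight] using ih) ?_
    rw [tailEsymm_one]
    simpa using hpos

theorem branchWeight_nonneg (ht : ∀ i, 0 ≤ t i) (hpos : 0 < ∑' i, t i) (i n : ℕ) :
    0 ≤ branchWeight t i n := by
  rw [branchWeight]
  split_ifs
  · simp
  · exact mul_nonneg (ht i) (treeWeight_pos ht hpos n).le

theorem branchWeight_pos (ht : ∀ i, 0 ≤ t i) (hpos : 0 < ∑' i, t i) {i : ℕ} (hi : 0 < t i)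
    (n : ℕ) : 0 < branchWeight t i n := by
  rw [branchWeight]
  split_ifs
  · simp
  · exact mul_pos hi (treeWeight_pos ht hpos n)

theorem forestWeight_pos (ht : ∀ i, 0 ≤ t i) (hpos : 0 < ∑' i, t i) {i : ℕ}
    (hi : 0 < ∑' j, t (i + j)) (n : ℕ) : 0 < forestWeight t i n := by
  rcases n with _ | n
  · simp
  rw [forestWeight, lagrangePair]
  refine lt_of_lt_of_le ?_ (Finset.single_le_sum (f := fun j => _ * _) (fun j _ => mul_nonneg
    (lagrangeCoeff_nonneg (tailEsymm_nonneg ht 0) _ j) (tailEsymm_nonneg ht i j))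
    (show 1 ∈ Finset.range (n + 1 + 1) by simp))
  refine mul_pos (by simpa [treeWeight] using treeWeight_pos ht hpos (n + 1)) ?_
  rwa [tailEsymm_one]

theorem branchWeight_eq (i n : ℕ) : branchWeight t i n =
    (if n = 0 then 1 else 0) + t i * lagrangeCoeff (tailEsymm t 0) n 1 := by
  rcases n with _ | n
  · simp
  · simp [branchWeight, treeWeight]

/-- The coefficients of `1 + t i * x`. -/
noncomputable def branchCoeff (t : ℕ → ℝ) (i m : ℕ) : ℝ :=
  if m = 0 then 1 else if m = 1 then t i else 0

theorem branchCoeff_nonneg (ht : ∀ i, 0 ≤ t i) (i m : ℕ) : 0 ≤ branchCoeff t i m := by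
  rw [branchCoeff]; split_ifs <;> simp [ht]

theorem branchWeight_eq_lagrangePair (i n : ℕ) : branchWeight t i n =
    lagrangePair (tailEsymm t 0) (branchCoeff t i) n := by
  rw [branchWeight_eq, lagrangePair_eq_sum (M := n + 2) _ (by omega), Finset.sum_range_succ',
    Finset.sum_range_succ', Finset.sum_eq_zero]
  · rcases n with _ | n <;> simp [branchCoeff, mul_comm]
  · intro j _
    simp [branchCoeff]

theorem mk_branchCoeff (i : ℕ) :
    PowerSeries.mk (branchCoeff t i) = 1 + PowerSeries.C (t i) * PowerSeries.X := by
  ext m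
  rw [map_add, PowerSeries.coeff_C_mul, PowerSeries.coeff_one, PowerSeries.coeff_X,
    PowerSeries.coeff_mk, branchCoeff]
  split_ifs <;> simp_all

theorem logConcaveSeq_branchCoeff (ht : ∀ i, 0 ≤ t i) (i : ℕ) :
    LogConcaveSeq (branchCoeff t i) := by
  apply logConcaveSeq_of_succ
  intro a b hab
  rcases b with _ | b
  · obtain rfl : a = 0 := by omega
    exact (mul_comm _ _).le
  · rw [show branchCoeff t i (b + 1 + 1) = 0 by simp [branchCoeff], mul_zero]
    exact mul_nonneg (branchCoeff_nonneg ht _ _) (branchCoeff_nonneg ht _ _)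

/-- The coefficient form of splitting off the factor `1 + t i T`: `h1` expands the factor and `h2`
uses `T^(1+j) = T T^j`. -/
theorem forestWeight_eq_sum (ht : ∀ i, 0 ≤ t i) (hs : Summable t) (i n : ℕ) :
    forestWeight t i n =
      ∑ l ∈ Finset.range (n + 1), branchWeight t i l * forestWeight t (i + 1) (n - l) := by
  set e := tailEsymm t 0 with he
  have h1 : forestWeight t i n = forestWeight t (i + 1) n +
      t i * ∑ j ∈ Finset.range (n + 1), lagrangeCoeff e n (1 + j) * tailEsymm t (i + 1) j := by
    rw [forestWeight, forestWeight, ← he, lagrangePair_eq_sum (M := n + 2) _ (by omega),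
      lagrangePair_eq_sum (M := n + 2) _ (by omega), Finset.sum_range_succ',
      Finset.sum_range_succ' _ (n + 1), Finset.mul_sum]
    simp only [tailEsymm_succ ht hs i, tailEsymm_zero, mul_add, Finset.sum_add_distrib]
    rw [add_right_comm]
    congr 1
    exact Finset.sum_congr rfl fun j _ => by rw [add_comm 1 j]; ring
  have h2 : ∑ j ∈ Finset.range (n + 1), lagrangeCoeff e n (1 + j) * tailEsymm t (i + 1) j =
      ∑ l ∈ Finset.range (n + 1), lagrangeCoeff e l 1 * forestWeight t (i + 1) (n - l) := by
    simp only [lagrangeCoeff_add, Finset.sum_mul,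
      Finset.Nat.sum_antidiagonal_eq_sum_range_succ_mk]
    rw [Finset.sum_comm]
    refine Finset.sum_congr rfl fun l hl => ?_
    rw [forestWeight, ← he, lagrangePair_eq_sum (M := n + 1) _ (by omega), Finset.mul_sum]
    exact Finset.sum_congr rfl fun j _ => by ring
  simp only [branchWeight_eq, add_mul, Finset.sum_add_distrib]
  rw [h1, h2, Finset.mul_sum, ← he]
  congr 1
  · rw [Finset.sum_range_succ']; simp
  · exact Finset.sum_congr rfl fun j _ => by ring

/-- For `m = n` this compares the product with its factor, their quotient being `1 + t i x`;
log-convexity extends it to `m < n`. -/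
theorem forestWeight_ratio_le (ht : ∀ i, 0 ≤ t i) (hs : Summable t) (i : ℕ) {m n : ℕ}
    (hm : m ≤ n) : forestWeight t (i + 1) (m + 1) * forestWeight t i n ≤
      forestWeight t (i + 1) m * forestWeight t i (n + 1) := by
  have he := tailEsymm_nonneg ht 0
  have hlc := logConcaveSeq_tailEsymm ht hs 0
  obtain ⟨G, hG, hfac⟩ := exists_mk_tailEsymm_zero_eq ht hs (i + 1)
  refine ratio_le_of_logConvex (forestWeight_nonneg ht _) (forestWeight_nonneg ht _)
    (lagrangePair_sq_le he hlc (tailEsymm_nonneg ht _) (logConcaveSeq_tailEsymm ht hs _) hG hfac)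
    ?_ m hm
  rw [mul_comm]
  refine lagrangePair_mul_le he hlc ?_ n
  refine (logConcaveSeq_tailEsymm ht hs (i + 1)).likelihoodRatioLE_mul (tailEsymm_nonneg ht _)
    (coeff_one_add_C_mul_X_nonneg (ht i)) fun m => ?_
  rw [← mk_tailEsymm_eq ht hs, PowerSeries.coeff_mk]

theorem branchWeight_ratio_le (ht : ∀ i, 0 ≤ t i) (hs : Summable t) (i : ℕ) {m n : ℕ}
    (hm : m ≤ n) : branchWeight t i (m + 1) * forestWeight t i n ≤
      branchWeight t i m * forestWeight t i (n + 1) := by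
  have he := tailEsymm_nonneg ht 0
  have hlc := logConcaveSeq_tailEsymm ht hs 0
  obtain ⟨G, hG, hfac⟩ := exists_mk_tailEsymm_zero_eq ht hs i
  simp only [branchWeight_eq_lagrangePair]
  refine ratio_le_of_logConvex (lagrangePair_nonneg he (branchCoeff_nonneg ht i))
    (forestWeight_nonneg ht _)
    (lagrangePair_sq_le he hlc (branchCoeff_nonneg ht i) (logConcaveSeq_branchCoeff ht i)
      (G := G * PowerSeries.mk (tailEsymm t (i + 1)))
      (coeff_mul_nonneg hG fun m => by simp [tailEsymm_nonneg ht]) ?_) ?_ m hm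
  · rw [hfac, mk_tailEsymm_eq ht hs i, mk_branchCoeff]; ring
  rw [mul_comm]
  refine lagrangePair_mul_le he hlc ?_ n
  refine (logConcaveSeq_branchCoeff ht i).likelihoodRatioLE_mul (branchCoeff_nonneg ht i)
    (c := PowerSeries.mk (tailEsymm t (i + 1))) (fun m => by simp [tailEsymm_nonneg ht])
    fun m => ?_
  rw [mk_branchCoeff, mul_comm, ← mk_tailEsymm_eq ht hs, PowerSeries.coeff_mk]

end weights

/-! ### Growth probabilities -/

/-- The probability that a forest with edges of types `≥ i`, `k` vertices of which lie in the
branch of type `i` and `m` in the others, grows in the branch of type `i`. -/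
noncomputable def growProb (t : ℕ → ℝ) (i k m : ℕ) : ℝ :=
  if forestWeight t i (k + m + 1) = 0 then 0 else
    transportFlow (branchWeight t i) (forestWeight t (i + 1))
      (forestWeight t i (k + m) / forestWeight t i (k + m + 1)) k m /
      (branchWeight t i k * forestWeight t (i + 1) m)

/-- The ratio of the weights of forests with `m - 1` and with `m` vertices. -/
noncomputable def forestRatio (t : ℕ → ℝ) (i m : ℕ) : ℝ :=
  if m = 0 then 0 else forestWeight t i (m - 1) / forestWeight t i m

section growProb

variable {t : ℕ → ℝ}

theorem transportFlow_branch_add_swap (ht : ∀ i, 0 ≤ t i) (hs : Summable t) {i k m : ℕ}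
    (h : forestWeight t i (k + m + 1) ≠ 0) :
    transportFlow (branchWeight t i) (forestWeight t (i + 1))
      (forestWeight t i (k + m) / forestWeight t i (k + m + 1)) k m +
    transportFlow (forestWeight t (i + 1)) (branchWeight t i)
      (forestWeight t i (k + m) / forestWeight t i (k + m + 1)) m k =
      branchWeight t i k * forestWeight t (i + 1) m := by
  apply transportFlow_add_swap
  rw [← forestWeight_eq_sum ht hs, ← forestWeight_eq_sum ht hs, div_mul_cancel₀ _ h]

theorem growProb_nonneg (ht : ∀ i, 0 ≤ t i) (hs : Summable t) (hpos : 0 < ∑' i, t i)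
    (i k m : ℕ) : 0 ≤ growProb t i k m := by
  rw [growProb]
  split_ifs with h
  · rfl
  have hS := (forestWeight_nonneg ht i (k + m + 1)).lt_of_ne' h
  refine div_nonneg (transportFlow_nonneg (branchWeight_nonneg ht hpos i) fun q hq => ?_)
    (mul_nonneg (branchWeight_nonneg ht hpos _ _) (forestWeight_nonneg ht _ _))
  rw [mul_div_assoc', div_le_iff₀ hS]
  exact forestWeight_ratio_le ht hs i hq

theorem growProb_le_one (ht : ∀ i, 0 ≤ t i) (hs : Summable t) (hpos : 0 < ∑' i, t i)
    (i k m : ℕ) : growProb t i k m ≤ 1 := by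
  rw [growProb]
  split_ifs with h
  · simp
  have hS := (forestWeight_nonneg ht i (k + m + 1)).lt_of_ne' h
  refine div_le_one_of_le₀ ?_
    (mul_nonneg (branchWeight_nonneg ht hpos _ _) (forestWeight_nonneg ht _ _))
  rw [← transportFlow_branch_add_swap ht hs h]
  refine le_add_of_nonneg_right (transportFlow_nonneg (forestWeight_nonneg ht _) fun q hq => ?_)
  rw [mul_div_assoc', div_le_iff₀ hS]
  exact branchWeight_ratio_le ht hs i (by omega)

/-- Here `1 + t i T` is `1`, so both forest weights agree and the only term of the flow cancels.
Hence no vertex of weight zero is ever created. -/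
theorem growProb_eq_zero (ht : ∀ i, 0 ≤ t i) (hs : Summable t) {i : ℕ} (hi : t i = 0)
    (k m : ℕ) : growProb t i k m = 0 := by
  rw [growProb]
  split_ifs with h
  · rfl
  have hb : ∀ l, branchWeight t i (l + 1) = 0 := fun l => by simp [branchWeight, hi]
  have hS : ∀ n, forestWeight t i n = forestWeight t (i + 1) n := fun n => by
    rw [forestWeight_eq_sum ht hs, Finset.sum_range_succ']
    simp [hb]
  rw [transportFlow, Finset.sum_range_succ', Finset.sum_eq_zero fun l _ => by rw [hb, zero_mul],
    ← hS, Nat.sub_zero, Nat.sub_zero, ← hS, ← hS, mul_div_cancel₀ _ h]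
  simp

theorem tsum_tail_pos (ht : ∀ i, 0 ≤ t i) (hs : Summable t) {i j : ℕ} (hij : i ≤ j)
    (hj : 0 < t j) : 0 < ∑' l, t (i + l) := by
  refine (summable_comp_add_left hs i).tsum_pos (fun l => ht _) (j - i) ?_
  rwa [Nat.add_sub_cancel' hij]

theorem tsum_tail_pos_of_succ (ht : ∀ i, 0 ≤ t i) (hs : Summable t) {i : ℕ}
    (h : 0 < ∑' l, t (i + 1 + l)) : 0 < ∑' l, t (i + l) := by
  rw [(summable_comp_add_left hs i).tsum_eq_zero_add]
  refine add_pos_of_nonneg_of_pos (ht _) ?_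
  simpa [add_assoc, add_comm, add_left_comm] using h

theorem growProb_zero_right (ht : ∀ i, 0 ≤ t i) (hs : Summable t) (hpos : 0 < ∑' i, t i)
    {i : ℕ} (hi : 0 < t i) (k : ℕ) :
    growProb t i k 0 * (branchWeight t i k / branchWeight t i (k + 1)) =
      forestWeight t i k / forestWeight t i (k + 1) := by
  have hS := (forestWeight_pos ht hpos (tsum_tail_pos ht hs le_rfl hi) (k + 1)).ne'
  have ha := fun k => (branchWeight_pos ht hpos hi k).ne'
  have h := transportFlow_branch_add_swap ht hs (i := i) (k := k) (m := 0) hS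
  have h' : transportFlow (forestWeight t (i + 1)) (branchWeight t i)
      (forestWeight t i (k + 0) / forestWeight t i (k + 0 + 1)) 0 k = branchWeight t i k -
        branchWeight t i (k + 1) * (forestWeight t i k / forestWeight t i (k + 1)) := by
    simp [transportFlow]
  rw [h', forestWeight_zero, mul_one] at h
  have ha1 := ha k
  have ha2 := ha (k + 1)
  rw [growProb, if_neg hS, forestWeight_zero, mul_one, eq_sub_of_add_eq h]
  field_simp
  ring

theorem one_sub_growProb_mul (ht : ∀ i, 0 ≤ t i) (hs : Summable t) (hpos : 0 < ∑' i, t i)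
    {i : ℕ} (hi : 0 < ∑' j, t (i + 1 + j)) (m : ℕ) :
    (1 - growProb t i 0 m) * (forestWeight t (i + 1) m / forestWeight t (i + 1) (m + 1)) =
      forestWeight t i m / forestWeight t i (m + 1) := by
  have hS := (forestWeight_pos ht hpos (tsum_tail_pos_of_succ ht hs hi) (m + 1)).ne'
  have hb1 := (forestWeight_pos ht hpos hi m).ne'
  have hb2 := (forestWeight_pos ht hpos hi (m + 1)).ne'
  rw [growProb, if_neg (by rwa [zero_add]), branchWeight_zero, one_mul, transportFlow]
  simp only [zero_add, Finset.sum_range_one, branchWeight_zero, one_mul, Nat.sub_zero]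
  field_simp
  ring

theorem growProb_add_one_sub_growProb (ht : ∀ i, 0 ≤ t i) (hs : Summable t)
    (hpos : 0 < ∑' i, t i) {i : ℕ} (hi : 0 < t i) (hi' : 0 < ∑' j, t (i + 1 + j)) (k m : ℕ) :
    growProb t i k (m + 1) * (branchWeight t i k / branchWeight t i (k + 1)) +
      (1 - growProb t i (k + 1) m) *
        (forestWeight t (i + 1) m / forestWeight t (i + 1) (m + 1)) =
      forestWeight t i (k + m + 1) / forestWeight t i (k + m + 2) := by
  have hS := (forestWeight_pos ht hpos (tsum_tail_pos ht hs le_rfl hi) (k + m + 2)).ne'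
  have hb1 := (forestWeight_pos ht hpos hi' m).ne'
  have hb2 := (forestWeight_pos ht hpos hi' (m + 1)).ne'
  have ha1 := (branchWeight_pos ht hpos hi k).ne'
  have ha2 := (branchWeight_pos ht hpos hi (k + 1)).ne'
  rw [growProb, growProb, show k + (m + 1) = k + m + 1 by ring,
    show k + 1 + m = k + m + 1 by ring, if_neg hS, if_neg hS, transportFlow_succ]
  generalize transportFlow _ _ _ k (m + 1) = F
  field_simp
  ring

/-- Balance at `(k, m)`, which is reached from `(k - 1, m)` or `(k, m - 1)`. For `m = 0` the
truncated `m - 1` is harmless, its factor `forestRatio t (i + 1) 0` being `0`. -/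
theorem forestRatio_add (ht : ∀ i, 0 ≤ t i) (hs : Summable t) (hpos : 0 < ∑' i, t i)
    {i k m : ℕ} (hk : k ≠ 0 → 0 < t i) (hm : m ≠ 0 → 0 < ∑' j, t (i + 1 + j)) :
    forestRatio t i (k + m) =
      (if k = 0 then 0 else
        growProb t i (k - 1) m * (branchWeight t i (k - 1) / branchWeight t i k)) +
      (1 - growProb t i k (m - 1)) * forestRatio t (i + 1) m := by
  rcases k with _ | k <;> rcases m with _ | m
  · simp [forestRatio]
  · simpa [forestRatio] using (one_sub_growProb_mul ht hs hpos (hm (by omega)) m).symm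
  · simpa [forestRatio] using (growProb_zero_right ht hs hpos (hk (by omega)) k).symm
  · have := growProb_add_one_sub_growProb ht hs hpos (hk (by omega)) (hm (by omega)) k m
    simp only [forestRatio, Nat.add_sub_cancel, Nat.succ_ne_zero, if_false]
    rw [this, if_neg (by omega), show k + 1 + (m + 1) = k + m + 2 by ring]
    simp

/-- Branch sizes `k` and tail sums `m` of branch sizes, with branches only where `t` is
positive. -/
structure BranchSizes (t : ℕ → ℝ) (k m : ℕ → ℕ) : Prop where
  eq_add : ∀ j, m j = k j + m (j + 1)
  eventually_zero : ∃ M, ∀ j, M ≤ j → m j = 0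
  pos : ∀ j, k j ≠ 0 → 0 < t j

theorem BranchSizes.tail_pos {k m : ℕ → ℕ} (h : BranchSizes t k m) (ht : ∀ i, 0 ≤ t i)
    (hs : Summable t) {i : ℕ} (hi : m i ≠ 0) : 0 < ∑' j, t (i + j) := by
  by_contra hcon
  have hk : ∀ j, i ≤ j → k j = 0 := fun j hij => by
    by_contra hj
    exact hcon (tsum_tail_pos ht hs hij (h.pos j hj))
  have hm : ∀ n, m (i + n) = m i := fun n => by
    induction n with
    | zero => rfl
    | succ n ih =>
      have := h.eq_add (i + n)
      rw [hk _ (by omega), zero_add] at this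
      rw [← add_assoc, ← this, ih]
  obtain ⟨M, hM⟩ := h.eventually_zero
  exact hi (by rw [← hm M, hM _ (by omega)])

/-- Iterating `forestRatio_add` over the types telescopes; the remainder vanishes once the tail is
empty. -/
theorem BranchSizes.sum_growProb {k m : ℕ → ℕ} (h : BranchSizes t k m) (ht : ∀ i, 0 ≤ t i)
    (hs : Summable t) (hpos : 0 < ∑' i, t i) {M : ℕ} (hM : m M = 0) :
    ∑ j ∈ Finset.range M, (∏ l ∈ Finset.range j, (1 - growProb t l (k l) (m (l + 1) - 1))) *
      (if k j = 0 then 0 else growProb t j (k j - 1) (m (j + 1)) *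
        (branchWeight t j (k j - 1) / branchWeight t j (k j))) = forestRatio t 0 (m 0) := by
  have key : ∀ i, ∑ j ∈ Finset.range i,
      (∏ l ∈ Finset.range j, (1 - growProb t l (k l) (m (l + 1) - 1))) *
      (if k j = 0 then 0 else growProb t j (k j - 1) (m (j + 1)) *
        (branchWeight t j (k j - 1) / branchWeight t j (k j))) +
      (∏ l ∈ Finset.range i, (1 - growProb t l (k l) (m (l + 1) - 1))) * forestRatio t i (m i) =
        forestRatio t 0 (m 0) := by
    intro i
    induction i with
    | zero => simp
    | succ i ih =>
      rw [h.eq_add i, forestRatio_add ht hs hpos (h.pos i) fun hi => h.tail_pos ht hs hi] at ih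
      rw [← ih, Finset.sum_range_succ, Finset.prod_range_succ]
      ring
  have := key M
  rwa [hM, show forestRatio t M 0 = 0 by simp [forestRatio], mul_zero, add_zero] at this

theorem forestWeight_succ_eq_zero {i : ℕ} (h : ∀ j, t (i + j) = 0) (n : ℕ) :
    forestWeight t i (n + 1) = 0 := by
  rw [forestWeight, lagrangePair]
  refine Finset.sum_eq_zero fun j _ => ?_
  rcases j with _ | j
  · simp
  · simp [tailEsymm, h]

theorem BranchSizes.tendsto_prod {k m : ℕ → ℕ} (h : BranchSizes t k m) (ht : ∀ i, 0 ≤ t i)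
    (hs : Summable t) (hpos : 0 < ∑' i, t i) :
    Filter.Tendsto (fun n => ∏ l ∈ Finset.range n, (1 - growProb t l (k l) (m (l + 1))))
      Filter.atTop (nhds 0) := by
  by_cases hex : ∃ i, ¬ 0 < ∑' l, t (i + l)
  -- `i` is the last type of positive weight: its coin succeeds with probability one, so the product
  -- is eventually zero.
  · obtain ⟨i, hi0, hi1⟩ : ∃ i, 0 < ∑' l, t (i + l) ∧ ¬ 0 < ∑' l, t (i + 1 + l) := by
      by_contra! hcon
      obtain ⟨i, hi⟩ := hex
      refine hi ?_
      clear hi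
      induction i with
      | zero => simpa using hpos
      | succ i ih => exact hcon i ih
    have hz : ∀ j, t (i + 1 + j) = 0 := fun j => by
      by_contra hj
      exact hi1 (tsum_tail_pos ht hs (j := i + 1 + j) (by omega) ((ht _).lt_of_ne' hj))
    have hti : 0 < t i := by
      refine (ht i).lt_of_ne' fun h0 => hi0.ne' ?_
      rw [(summable_comp_add_left hs i).tsum_eq_zero_add]
      have hz' : ∀ j, t (i + (j + 1)) = 0 := fun j => by
        rw [show i + (j + 1) = i + 1 + j by ring, hz]
      simp only [add_zero, h0, hz', tsum_zero]
    have hm : m (i + 1) = 0 := by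
      by_contra hm
      exact hi1 (h.tail_pos ht hs hm)
    have hSa : ∀ n, forestWeight t i n = branchWeight t i n := fun n => by
      rw [forestWeight_eq_sum ht hs, Finset.sum_range_succ, Nat.sub_self, forestWeight_zero,
        mul_one, Finset.sum_eq_zero, zero_add]
      intro l hl
      simp only [Finset.mem_range] at hl
      rw [show n - l = n - l - 1 + 1 by omega, forestWeight_succ_eq_zero hz, mul_zero]
    have hp : growProb t i (k i) (m (i + 1)) = 1 := by
      have h1 := growProb_zero_right ht hs hpos hti (k i)
      rw [hSa, hSa] at h1
      rw [hm]
      exact mul_right_cancel₀ (div_ne_zero (branchWeight_pos ht hpos hti _).ne'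
        (branchWeight_pos ht hpos hti _).ne') (by rw [h1, one_mul])
    refine tendsto_const_nhds.congr' ?_
    filter_upwards [Filter.eventually_gt_atTop i] with n hn
    exact (Finset.prod_eq_zero (Finset.mem_range.2 hn) (by rw [hp, sub_self])).symm
  · push Not at hex
    obtain ⟨M, hM⟩ := h.eventually_zero
    rw [← Filter.tendsto_add_atTop_iff_nat M]
    -- Beyond `M` all branches are empty and failure probabilities are quotients of consecutive tail
    -- sums, so the product telescopes to a tail of a convergent series.
    have hf : ∀ l, M ≤ l → 1 - growProb t l (k l) (m (l + 1)) =
        (∑' j, t (l + 1 + j)) / ∑' j, t (l + j) := fun l hl => by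
      have h1 := h.eq_add l
      rw [hM l hl] at h1
      have h2 := one_sub_growProb_mul ht hs hpos (hex (l + 1)) 0
      rw [forestWeight_zero, forestWeight_zero, zero_add, forestWeight_one, forestWeight_one] at h2
      rw [show k l = 0 by omega, show m (l + 1) = 0 by omega]
      have p1 := (hex (l + 1)).ne'
      have p2 := (hex l).ne'
      field_simp at h2 ⊢
      linarith
    have hprod : ∀ n, ∏ l ∈ Finset.range (n + M), (1 - growProb t l (k l) (m (l + 1))) =
        (∏ l ∈ Finset.range M, (1 - growProb t l (k l) (m (l + 1)))) *
          ((∑' j, t (j + (n + M))) / ∑' j, t (M + j)) := fun n => by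
      induction n with
      | zero =>
        have := (hex M).ne'
        rw [zero_add]
        simp only [add_comm _ M]
        rw [div_self this, mul_one]
      | succ n ih =>
        have p2 := (hex (n + M)).ne'
        rw [show n + 1 + M = n + M + 1 by ring, Finset.prod_range_succ, ih, hf _ (by omega)]
        simp only [add_comm _ (n + M), add_comm _ (n + M + 1)]
        field_simp
    simp only [hprod]
    have h3 := ((tendsto_sum_nat_add t).comp (Filter.tendsto_add_atTop_nat M)).div_const
      (∑' j, t (M + j))
    simpa using h3.const_mul (∏ l ∈ Finset.range M, (1 - growProb t l (k l) (m (l + 1))))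

theorem BranchSizes.hasSum_growProb {k m : ℕ → ℕ} (h : BranchSizes t k m) (ht : ∀ i, 0 ≤ t i)
    (hs : Summable t) (hpos : 0 < ∑' i, t i) :
    HasSum (fun j => (∏ l ∈ Finset.range j, (1 - growProb t l (k l) (m (l + 1)))) *
      growProb t j (k j) (m (j + 1))) 1 := by
  rw [hasSum_iff_tendsto_nat_of_nonneg fun j => mul_nonneg (Finset.prod_nonneg fun l _ =>
    sub_nonneg.2 (growProb_le_one ht hs hpos _ _ _)) (growProb_nonneg ht hs hpos _ _ _)]
  have : ∀ n, ∑ j ∈ Finset.range n,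
      (∏ l ∈ Finset.range j, (1 - growProb t l (k l) (m (l + 1)))) *
        growProb t j (k j) (m (j + 1)) =
      1 - ∏ l ∈ Finset.range n, (1 - growProb t l (k l) (m (l + 1))) := fun n => by
    induction n with
    | zero => simp
    | succ n ih => rw [Finset.sum_range_succ, ih, Finset.prod_range_succ]; ring
  simp only [this]
  simpa using (h.tendsto_prod ht hs hpos).const_sub 1

end growProb

/-! ### Growing a tree by one leaf -/

/-- The words `v` such that `i :: v` lies in `τ`. -/
noncomputable def subtreeAt (τ : Finset UlamHarris) (i : ℕ+) : Finset UlamHarris :=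
  τ.preimage (fun v => i :: v) (List.cons_injective.injOn)

/-- The number of words in `τ` with first letter `j + 1`. -/
noncomputable def branchSize (τ : Finset UlamHarris) (j : ℕ) : ℕ :=
  (subtreeAt τ j.succPNat).card

open Classical in
/-- The number of words in `τ` with first letter at least `j + 1`. -/
noncomputable def tailSize (τ : Finset UlamHarris) (j : ℕ) : ℕ :=
  (τ.filter fun u => ∃ (i : ℕ+) (v : UlamHarris), u = i :: v ∧ j ≤ i.natPred).card

/-- The parent of every word in `τ` lies in `τ`. -/
def ParentClosed (τ : Finset UlamHarris) : Prop :=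
  ∀ (u : UlamHarris) (i : ℕ+), u ++ [i] ∈ τ → u ∈ τ

/-- The weight of the last letter of a word. -/
noncomputable def lastWeight (θ : ℕ+ → ℝ) (u : UlamHarris) : ℝ :=
  u.getLast?.elim 1 θ

/-- The probability of growing `τ` in the branch whose words start with `j + 1`. -/
noncomputable def branchProb (t : ℕ → ℝ) (τ : Finset UlamHarris) (j : ℕ) : ℝ :=
  (∏ l ∈ Finset.range j, (1 - growProb t l (branchSize τ l) (tailSize τ (l + 1)))) *
    growProb t j (branchSize τ j) (tailSize τ (j + 1))

/-- The probability of growing `τ` by the vertex `u`. -/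
noncomputable def growthProb (t : ℕ → ℝ) : UlamHarris → Finset UlamHarris → ℝ
  | [], τ => if τ = ∅ then 1 else 0
  | i :: v, τ => if τ = ∅ then 0 else
      branchProb t τ i.natPred * growthProb t v (subtreeAt τ i)

section growth

variable {t : ℕ → ℝ} {θ : ℕ+ → ℝ} {τ : Finset UlamHarris}

@[simp] theorem mem_subtreeAt {i : ℕ+} {v : UlamHarris} : v ∈ subtreeAt τ i ↔ i :: v ∈ τ := by
  simp [subtreeAt]

@[simp] theorem lastWeight_nil : lastWeight θ [] = 1 := by simp [lastWeight]

theorem lastWeight_cons (i : ℕ+) (v : UlamHarris) :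
    lastWeight θ (i :: v) = if v = [] then θ i else lastWeight θ v := by
  rcases v with _ | ⟨j, v⟩
  · simp [lastWeight]
  · simp [lastWeight, List.getLast?_cons_cons]

theorem ParentClosed.subtreeAt (h : ParentClosed τ) (i : ℕ+) : ParentClosed (subtreeAt τ i) := by
  intro u j hu
  rw [mem_subtreeAt] at hu ⊢
  exact h (i :: u) j hu

theorem ParentClosed.mem_of_append_mem (h : ParentClosed τ) (u v : UlamHarris) (hv : u ++ v ∈ τ) :
    u ∈ τ := by
  induction v using List.reverseRecOn with
  | nil => simpa using hv
  | append_singleton v i ih => exact ih (h _ i (by simpa using hv))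

theorem ParentClosed.nil_mem (h : ParentClosed τ) (hne : τ.Nonempty) : [] ∈ τ := by
  obtain ⟨u, hu⟩ := hne
  exact h.mem_of_append_mem [] u hu

theorem card_subtreeAt_lt (hτ : [] ∈ τ) (i : ℕ+) : (subtreeAt τ i).card < τ.card := by
  classical
  calc (subtreeAt τ i).card = ((subtreeAt τ i).image (i :: ·)).card :=
        (Finset.card_image_of_injective _ List.cons_injective).symm
    _ ≤ (τ.erase []).card := Finset.card_le_card fun u hu => by
        obtain ⟨v, hv, rfl⟩ := Finset.mem_image.1 hu
        simpa using hv
    _ < τ.card := Finset.card_erase_lt_of_mem hτ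

theorem lastWeight_pos_of_subtreeAt (h : ∀ u ∈ τ, 0 < lastWeight θ u) (i : ℕ+) :
    ∀ v ∈ subtreeAt τ i, 0 < lastWeight θ v := by
  intro v hv
  have := h _ (mem_subtreeAt.1 hv)
  rw [lastWeight_cons] at this
  split_ifs at this with h0
  · simp [h0]
  · exact this

theorem tailSize_eq_add (τ : Finset UlamHarris) (j : ℕ) :
    tailSize τ j = branchSize τ j + tailSize τ (j + 1) := by
  classical
  have e : branchSize τ j = ((subtreeAt τ j.succPNat).image (j.succPNat :: ·)).card :=
    (Finset.card_image_of_injective _ List.cons_injective).symm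
  rw [e, tailSize, tailSize, ← Finset.card_union_of_disjoint]
  · congr 1
    ext u
    simp only [Finset.mem_filter, Finset.mem_union, Finset.mem_image, mem_subtreeAt]
    constructor
    · rintro ⟨hu, i, v, rfl, hi⟩
      rcases hi.eq_or_lt with rfl | hi
      · exact Or.inl ⟨v, by simpa using hu, by simp⟩
      · exact Or.inr ⟨hu, i, v, rfl, hi⟩
    · rintro (⟨v, hv, rfl⟩ | ⟨hu, i, v, rfl, hi⟩)
      · exact ⟨hv, _, _, rfl, by simp⟩
      · exact ⟨hu, _, _, rfl, by omega⟩
  · rw [Finset.disjoint_left]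
    intro u hu hu'
    simp only [Finset.mem_filter, Finset.mem_image] at hu hu'
    obtain ⟨v, _, rfl⟩ := hu
    obtain ⟨_, i, w, hw, hi⟩ := hu'
    obtain ⟨rfl, rfl⟩ := List.cons.inj hw
    simp at hi

theorem exists_natPred_lt (τ : Finset UlamHarris) :
    ∃ M, ∀ (i : ℕ+) (v : UlamHarris), i :: v ∈ τ → i.natPred < M := by
  refine ⟨τ.sup (fun u => u.head?.elim 0 PNat.natPred) + 1, fun i v hv => ?_⟩
  have := Finset.le_sup (f := fun u : UlamHarris => u.head?.elim 0 PNat.natPred) hv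
  simp only [List.head?_cons, Option.elim_some] at this
  omega

theorem tailSize_eq_zero {M : ℕ} (hM : ∀ (i : ℕ+) (v : UlamHarris), i :: v ∈ τ → i.natPred < M)
    {j : ℕ} (hj : M ≤ j) : tailSize τ j = 0 := by
  classical
  rw [tailSize, Finset.card_eq_zero, Finset.filter_eq_empty_iff]
  rintro u hu ⟨i, v, rfl, hi⟩
  have := hM i v hu
  omega

theorem branchSizes_of_parentClosed (h : ParentClosed τ) (hpos : ∀ u ∈ τ, 0 < lastWeight θ u) :
    BranchSizes (fun j => θ j.succPNat) (branchSize τ) (tailSize τ) where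
  eq_add := tailSize_eq_add τ
  eventually_zero := by
    obtain ⟨M, hM⟩ := exists_natPred_lt τ
    exact ⟨M, fun j hj => tailSize_eq_zero hM hj⟩
  pos j hj := by
    obtain ⟨v, hv⟩ := Finset.card_pos.1 (Nat.pos_of_ne_zero hj)
    have := hpos _ (h.mem_of_append_mem [j.succPNat] v (by simpa using hv))
    simpa [lastWeight_cons] using this

theorem tailSize_zero (hτ : [] ∈ τ) : tailSize τ 0 = τ.card - 1 := by
  classical
  rw [tailSize, ← Finset.card_erase_of_mem hτ]
  congr 1
  ext u
  rcases u with _ | ⟨i, v⟩ <;> simp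

/-! ### Effect of removing a vertex on the branch sizes. -/

theorem subtreeAt_erase_self (i : ℕ+) (v : UlamHarris) :
    subtreeAt (τ.erase (i :: v)) i = (subtreeAt τ i).erase v := by
  ext w; simp

theorem branchSize_erase_self {j : ℕ} {v : UlamHarris} (hv : j.succPNat :: v ∈ τ) :
    branchSize (τ.erase (j.succPNat :: v)) j = branchSize τ j - 1 := by
  rw [branchSize, subtreeAt_erase_self, Finset.card_erase_of_mem (by simpa using hv), branchSize]

theorem branchSize_erase_of_ne {j l : ℕ} (h : l ≠ j) (v : UlamHarris) :
    branchSize (τ.erase (j.succPNat :: v)) l = branchSize τ l := by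
  rw [branchSize, branchSize]
  congr 1
  ext w
  have : l.succPNat ≠ j.succPNat := fun h' => h (Nat.succPNat_injective h')
  simp [this]

theorem tailSize_erase_of_le {j l : ℕ} (h : l ≤ j) {v : UlamHarris} (hv : j.succPNat :: v ∈ τ) :
    tailSize (τ.erase (j.succPNat :: v)) l = tailSize τ l - 1 := by
  classical
  rw [tailSize, tailSize, Finset.filter_erase, Finset.card_erase_of_mem]
  exact Finset.mem_filter.2 ⟨hv, _, _, rfl, by simpa using h⟩

theorem tailSize_erase_of_lt {j l : ℕ} (h : j < l) (v : UlamHarris) :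
    tailSize (τ.erase (j.succPNat :: v)) l = tailSize τ l := by
  classical
  rw [tailSize, tailSize, Finset.filter_erase, Finset.erase_eq_of_notMem]
  rintro hu
  obtain ⟨_, i, w, hw, hi⟩ := Finset.mem_filter.1 hu
  obtain ⟨rfl, rfl⟩ := List.cons.inj hw
  simp at hi
  omega

theorem branchProb_erase {j : ℕ} {v : UlamHarris} (hv : j.succPNat :: v ∈ τ) :
    branchProb t (τ.erase (j.succPNat :: v)) j =
      (∏ l ∈ Finset.range j, (1 - growProb t l (branchSize τ l) (tailSize τ (l + 1) - 1))) *
        growProb t j (branchSize τ j - 1) (tailSize τ (j + 1)) := by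
  rw [branchProb, branchSize_erase_self hv, tailSize_erase_of_lt (by omega)]
  congr 1
  refine Finset.prod_congr rfl fun l hl => ?_
  simp only [Finset.mem_range] at hl
  rw [branchSize_erase_of_ne (by omega), tailSize_erase_of_le (by omega) hv]

theorem branchProb_nonneg (ht : ∀ i, 0 ≤ t i) (hs : Summable t) (hpos : 0 < ∑' i, t i)
    (τ : Finset UlamHarris) (j : ℕ) : 0 ≤ branchProb t τ j :=
  mul_nonneg (Finset.prod_nonneg fun _ _ => sub_nonneg.2 (growProb_le_one ht hs hpos _ _ _))
    (growProb_nonneg ht hs hpos _ _ _)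

theorem growthProb_nonneg (ht : ∀ i, 0 ≤ t i) (hs : Summable t) (hpos : 0 < ∑' i, t i)
    (u : UlamHarris) (τ : Finset UlamHarris) : 0 ≤ growthProb t u τ := by
  induction u generalizing τ with
  | nil => rw [growthProb]; split_ifs <;> simp
  | cons i v ih =>
    rw [growthProb]
    split_ifs
    · simp
    · exact mul_nonneg (branchProb_nonneg ht hs hpos _ _) (ih _)

theorem sum_eq_nil_add_sum_subtreeAt (f : UlamHarris → ℝ) (hτ : [] ∈ τ) {M : ℕ}
    (hM : ∀ (i : ℕ+) (v : UlamHarris), i :: v ∈ τ → i.natPred < M) :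
    ∑ u ∈ τ, f u = f [] + ∑ j ∈ Finset.range M,
      ∑ v ∈ subtreeAt τ j.succPNat, f (j.succPNat :: v) := by
  classical
  have e : τ.erase [] = (Finset.range M).biUnion fun j =>
      (subtreeAt τ j.succPNat).image (j.succPNat :: ·) := by
    ext u
    simp only [Finset.mem_erase, Finset.mem_biUnion, Finset.mem_range, Finset.mem_image,
      mem_subtreeAt]
    constructor
    · rintro ⟨hu, hu'⟩
      rcases u with _ | ⟨i, v⟩
      · exact absurd rfl hu
      · exact ⟨i.natPred, hM i v hu', v, by simpa using hu', by simp⟩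
    · rintro ⟨j, _, v, hv, rfl⟩
      exact ⟨by simp, hv⟩
  rw [← Finset.add_sum_erase _ _ hτ, e, Finset.sum_biUnion]
  · congr 1
    refine Finset.sum_congr rfl fun j _ => ?_
    rw [Finset.sum_image fun a _ b _ h => List.cons_injective h]
  · intro j _ l _ hjl
    rw [Function.onFun, Finset.disjoint_left]
    intro u hu hu'
    obtain ⟨v, _, rfl⟩ := Finset.mem_image.1 hu
    obtain ⟨w, _, hw⟩ := Finset.mem_image.1 hu'
    exact hjl (Nat.succPNat_injective (List.cons.inj hw).1.symm)

theorem growthProb_nil_of_nonempty (h : τ.Nonempty) : growthProb t [] τ = 0 := by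
  rw [growthProb, if_neg h.ne_empty]

/-- The growth probabilities transport the weights of trees to the weights of the trees with one
more vertex. -/
theorem sum_growthProb_erase_div_lastWeight (hθ : ∀ i, 0 ≤ θ i)
    (hs : Summable fun j : ℕ => θ j.succPNat) (hpos : 0 < ∑' j : ℕ, θ j.succPNat)
    (τ : Finset UlamHarris) (hc : ParentClosed τ) (hτ : [] ∈ τ)
    (hw : ∀ u ∈ τ, 0 < lastWeight θ u) :
    ∑ u ∈ τ, growthProb (fun j => θ j.succPNat) u (τ.erase u) / lastWeight θ u =
      treeWeight (fun j => θ j.succPNat) (τ.card - 1) /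
        treeWeight (fun j => θ j.succPNat) τ.card := by
  set t : ℕ → ℝ := fun j => θ j.succPNat with ht_def
  have ht : ∀ j, 0 ≤ t j := fun j => hθ _
  induction hn : τ.card using Nat.strong_induction_on generalizing τ with
  | _ n ih =>
  have hcard : 0 < n := hn ▸ Finset.card_pos.2 ⟨_, hτ⟩
  rcases (Nat.succ_le_iff.2 hcard).eq_or_lt' with h1 | h1
  · obtain ⟨a, rfl⟩ := Finset.card_eq_one.1 (hn.trans h1)
    obtain rfl : [] = a := by simpa using hτ
    simp [h1, growthProb]
  have hne : (τ.erase []).Nonempty := by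
    rw [← Finset.card_pos, Finset.card_erase_of_mem hτ]; omega
  obtain ⟨M, hM⟩ := exists_natPred_lt τ
  have hB := branchSizes_of_parentClosed hc hw
  have inner : ∀ j, ∑ v ∈ subtreeAt τ j.succPNat,
      growthProb t v ((subtreeAt τ j.succPNat).erase v) / lastWeight θ (j.succPNat :: v) =
      if branchSize τ j = 0 then 0 else
        branchWeight t j (branchSize τ j - 1) / branchWeight t j (branchSize τ j) := by
    intro j
    split_ifs with hj
    · rw [Finset.card_eq_zero.1 hj, Finset.sum_empty]
    have hnil := (hc.subtreeAt j.succPNat).nil_mem (Finset.card_pos.1 (Nat.pos_of_ne_zero hj))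
    have htj : 0 < t j := hB.pos j hj
    -- A one-vertex branch is newly opened: its root contributes `1 / t j`. In a larger branch the
    -- induction hypothesis applies and `t j` cancels.
    by_cases hj1 : branchSize τ j = 1
    · obtain ⟨a, ha⟩ := Finset.card_eq_one.1 hj1
      rw [ha] at hnil
      obtain rfl : [] = a := by simpa using hnil
      rw [ha, hj1]
      simp [growthProb, branchWeight, lastWeight_cons, ht_def]
    · have hlt := card_subtreeAt_lt hτ j.succPNat
      have := ih _ (hn ▸ hlt) (subtreeAt τ j.succPNat) (hc.subtreeAt _) hnil
        (lastWeight_pos_of_subtreeAt hw _) rfl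
      change _ = treeWeight t (branchSize τ j - 1) / treeWeight t (branchSize τ j) at this
      rw [branchWeight, branchWeight, if_neg (by omega), if_neg hj,
        mul_div_mul_left _ _ htj.ne', ← this]
      refine Finset.sum_congr rfl fun v hv => ?_
      rw [lastWeight_cons]
      split_ifs with hv0
      · subst hv0
        rw [growthProb_nil_of_nonempty]
        · simp
        · rw [← Finset.card_pos, Finset.card_erase_of_mem hnil]
          change 0 < branchSize τ j - 1
          omega
      · rfl
  rw [sum_eq_nil_add_sum_subtreeAt _ hτ hM, growthProb_nil_of_nonempty hne, zero_div, zero_add]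
  have outer : ∀ j ∈ Finset.range M, ∑ v ∈ subtreeAt τ j.succPNat,
      growthProb t (j.succPNat :: v) (τ.erase (j.succPNat :: v)) /
        lastWeight θ (j.succPNat :: v) =
      (∏ l ∈ Finset.range j, (1 - growProb t l (branchSize τ l) (tailSize τ (l + 1) - 1))) *
      (if branchSize τ j = 0 then 0 else growProb t j (branchSize τ j - 1) (tailSize τ (j + 1)) *
        (branchWeight t j (branchSize τ j - 1) / branchWeight t j (branchSize τ j))) := by
    intro j _
    have e : (if branchSize τ j = 0 then 0 else
        growProb t j (branchSize τ j - 1) (tailSize τ (j + 1)) *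
          (branchWeight t j (branchSize τ j - 1) / branchWeight t j (branchSize τ j))) =
        growProb t j (branchSize τ j - 1) (tailSize τ (j + 1)) *
          if branchSize τ j = 0 then 0 else
            branchWeight t j (branchSize τ j - 1) / branchWeight t j (branchSize τ j) := by
      split_ifs <;> simp
    rw [e, ← inner, ← mul_assoc, Finset.mul_sum]
    refine Finset.sum_congr rfl fun v hv => ?_
    rw [mem_subtreeAt] at hv
    have hne' : τ.erase (j.succPNat :: v) ≠ ∅ :=
      Finset.ne_empty_of_mem (Finset.mem_erase.2 ⟨by simp, hτ⟩)
    rw [growthProb, if_neg hne', subtreeAt_erase_self, Nat.natPred_succPNat, branchProb_erase hv]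
    ring
  rw [Finset.sum_congr rfl outer, hB.sum_growProb ht hs hpos (tailSize_eq_zero hM le_rfl),
    tailSize_zero hτ, hn, forestRatio, if_neg (by omega), forestWeight_zero_left,
    forestWeight_zero_left]
  congr 2 <;> omega

theorem tsum_list_eq (f : UlamHarris → ENNReal) :
    ∑' u, f u = f [] + ∑' (j : ℕ) (v : UlamHarris), f (j.succPNat :: v) := by
  have hinj : Function.Injective fun p : ℕ × UlamHarris => p.1.succPNat :: p.2 := by
    rintro ⟨j, v⟩ ⟨l, w⟩ h
    obtain ⟨h1, h2⟩ := List.cons.inj h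
    exact Prod.ext (Nat.succPNat_injective h1) h2
  rw [ENNReal.tsum_eq_add_tsum_ite [], ← hinj.tsum_eq, ENNReal.tsum_prod']
  · simp
  · rintro (_ | ⟨i, v⟩) h
    · simp at h
    · exact ⟨(i.natPred, v), by simp⟩

/-- Inside each branch the total is one by induction on the size, so the sum reduces to that of the
branch probabilities. -/
theorem tsum_growthProb (hθ : ∀ i, 0 ≤ θ i)
    (hs : Summable fun j : ℕ => θ j.succPNat) (hpos : 0 < ∑' j : ℕ, θ j.succPNat)
    (τ : Finset UlamHarris) (hc : ParentClosed τ) (hw : ∀ u ∈ τ, 0 < lastWeight θ u) :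
    ∑' u, ENNReal.ofReal (growthProb (fun j => θ j.succPNat) u τ) = 1 := by
  set t : ℕ → ℝ := fun j => θ j.succPNat with ht_def
  have ht : ∀ j, 0 ≤ t j := fun j => hθ _
  induction hn : τ.card using Nat.strong_induction_on generalizing τ with
  | _ n ih =>
  rw [tsum_list_eq]
  rcases τ.eq_empty_or_nonempty with rfl | hne
  · simp [growthProb]
  have hτ := hc.nil_mem hne
  rw [growthProb_nil_of_nonempty hne, ENNReal.ofReal_zero, zero_add]
  have h1 : ∀ j : ℕ, ∑' v, ENNReal.ofReal (growthProb t (j.succPNat :: v) τ) =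
      ENNReal.ofReal (branchProb t τ j) := fun j => by
    simp only [growthProb, if_neg hne.ne_empty, Nat.natPred_succPNat,
      ENNReal.ofReal_mul (branchProb_nonneg ht hs hpos τ j)]
    rw [ENNReal.tsum_mul_left, ih _ (hn ▸ card_subtreeAt_lt hτ _) _ (hc.subtreeAt _)
      (lastWeight_pos_of_subtreeAt hw _) rfl, mul_one]
  have h2 := (branchSizes_of_parentClosed hc hw).hasSum_growProb ht hs hpos
  simp only [h1]
  rw [← ENNReal.ofReal_tsum_of_nonneg (fun j => branchProb_nonneg ht hs hpos τ j) h2.summable]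
  exact (congrArg ENNReal.ofReal h2.tsum_eq).trans ENNReal.ofReal_one

/-- The recursion ends with a non-zero value only at an empty subtree. Thus only leaves can have
been added last. -/
theorem append_notMem_of_growthProb_ne_zero {u : UlamHarris} (h : growthProb t u τ ≠ 0)
    (v : UlamHarris) : u ++ v ∉ τ := by
  induction u generalizing τ with
  | nil =>
    obtain rfl : τ = ∅ := by
      by_contra hne
      exact h (by rw [growthProb, if_neg hne])
    simp
  | cons i u ih =>
    rw [growthProb] at h
    split_ifs at h with hne
    · exact absurd rfl h
    simpa using ih (mul_ne_zero_iff.1 h).2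

theorem parentClosed_erase_of_growthProb_ne_zero {u : UlamHarris} (hc : ParentClosed τ)
    (h : growthProb t u (τ.erase u) ≠ 0) : ParentClosed (τ.erase u) := by
  intro v i hv
  refine Finset.mem_erase.2 ⟨?_, hc v i (Finset.mem_of_mem_erase hv)⟩
  rintro rfl
  exact append_notMem_of_growthProb_ne_zero h [i] hv

theorem growthProb_ne_zero (hθ : ∀ i, 0 ≤ θ i) (hs : Summable fun j : ℕ => θ j.succPNat)
    {u : UlamHarris} (hc : ParentClosed τ) (h : growthProb (fun j => θ j.succPNat) u τ ≠ 0) :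
    u ∉ τ ∧ ParentClosed (insert u τ) ∧ 0 < lastWeight θ u := by
  induction u generalizing τ with
  | nil =>
    obtain rfl : τ = ∅ := by
      by_contra hne
      exact h (by rw [growthProb, if_neg hne])
    refine ⟨by simp, fun u i hu => ?_, by simp⟩
    simp at hu
  | cons i v ih =>
    rw [growthProb] at h
    split_ifs at h with hne
    · exact absurd rfl h
    obtain ⟨h1, h2⟩ := mul_ne_zero_iff.1 h
    obtain ⟨hv, hcl, hpos⟩ := ih (hc.subtreeAt i) h2
    have hnil := hc.nil_mem (Finset.nonempty_iff_ne_empty.2 hne)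
    refine ⟨by simpa using hv, fun u a hu => ?_, ?_⟩
    · rcases Finset.mem_insert.1 hu with hu | hu
      · rcases u with _ | ⟨b, u⟩
        · exact Finset.mem_insert_of_mem hnil
        · obtain ⟨rfl, rfl⟩ := List.cons.inj hu
          rcases Finset.mem_insert.1 (hcl u a (Finset.mem_insert_self _ _)) with h' | h'
          · simp at h'
          · exact Finset.mem_insert_of_mem (mem_subtreeAt.1 h')
      · exact Finset.mem_insert_of_mem (hc u a hu)
    · rw [lastWeight_cons]
      split_ifs
      · refine (hθ i).lt_of_ne' fun h0 => h1 ?_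
        rw [branchProb, growProb_eq_zero (fun j => hθ _) hs (by simpa using h0), mul_zero]
      · exact hpos

end growth

/-! ### Markov chains with countable state space -/

/-- A homogeneous Markov chain with given transition probabilities on a countable set. -/
theorem exists_markovChain {α : Type} [Countable α] [MeasurableSpace α]
    [DiscreteMeasurableSpace α] (x₀ : α) (κ : α → PMF α) :
    ∃ P : Measure (ℕ → α), IsProbabilityMeasure P ∧ P {ω | ω 0 = x₀} = 1 ∧
      ∀ (n : ℕ) (Q : (ℕ → α) → Prop), (∀ ω ω', (∀ k ≤ n, ω k = ω' k) → Q ω → Q ω') → ∀ x y,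
        P {ω | (Q ω ∧ ω n = x) ∧ ω (n + 1) = y} = P {ω | Q ω ∧ ω n = x} * κ x y := by
  let K : (n : ℕ) → Kernel (Π _ : Finset.Iic n, α) α := fun n =>
    ⟨fun h => (κ (h ⟨n, Finset.mem_Iic.2 le_rfl⟩)).toMeasure,
      (Measurable.of_discrete (f := fun a => (κ a).toMeasure)).comp (measurable_pi_apply _)⟩
  have hK : ∀ n, IsMarkovKernel (K n) := fun n =>
    ⟨fun h => PMF.toMeasure.isProbabilityMeasure _⟩
  have hmeas : ∀ (n : ℕ) (A : Set (Π _ : Finset.Iic n, α)), MeasurableSet A :=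
    fun n A => A.to_countable.measurableSet
  let P : Measure (ℕ → α) := Kernel.traj (X := fun _ => α) K 0 fun _ => x₀
  have hP : IsProbabilityMeasure P := by dsimp only [P]; infer_instance
  refine ⟨P, hP, ?_, ?_⟩
  · have h := Kernel.traj_map_frestrictLe_apply (X := fun _ => α) (κ := K) 0 0 fun _ => x₀
    rw [Kernel.partialTraj_self, Kernel.id_apply] at h
    have h' := congrArg (fun μ => μ {h | h ⟨0, Finset.mem_Iic.2 le_rfl⟩ = x₀}) h
    rw [Measure.map_apply (by fun_prop) (hmeas _ _), Measure.dirac_apply' _ (hmeas _ _)] at h'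
    simpa using h'
  · intro n Q hQ x y
    -- A finite history is prolonged by the arbitrary value `x₀`; `Q` reads only the first
    -- coordinates, up to `n`.
    let E : (Π _ : Finset.Iic n, α) → ℕ → α := fun h k =>
      if hk : k ≤ n then h ⟨k, Finset.mem_Iic.2 hk⟩ else x₀
    let A : Set (Π _ : Finset.Iic n, α) :=
      {h | Q (E h) ∧ h ⟨n, Finset.mem_Iic.2 le_rfl⟩ = x}
    have hA : ∀ ω : ℕ → α, Preorder.frestrictLe (π := fun _ => α) n ω ∈ A ↔ Q ω ∧ ω n = x := by
      intro ω
      have hE : ∀ k ≤ n, ω k = E (Preorder.frestrictLe (π := fun _ => α) n ω) k := fun k hk => by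
        simp [E, hk]
      exact and_congr ⟨hQ _ _ fun k hk => (hE k hk).symm, hQ _ _ hE⟩ Iff.rfl
    have h := Kernel.partialTraj_compProd_eq_map_traj (X := fun _ => α) (κ := K)
      (Nat.zero_le n) (x₀ := fun _ => x₀)
    have h' := congrArg (fun μ => μ (A ×ˢ {y})) h
    rw [Measure.compProd_apply_prod (hmeas _ _) (measurableSet_singleton y),
      Measure.map_apply (by fun_prop) ((hmeas _ _).prod (measurableSet_singleton y)),
      setLIntegral_congr_fun (g := fun _ => κ x y) (hmeas _ _) ?_, setLIntegral_const,
      ← Kernel.traj_map_frestrictLe_apply, Measure.map_apply (by fun_prop) (hmeas _ _)] at h'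
    · have e1 : {ω : ℕ → α | (Q ω ∧ ω n = x) ∧ ω (n + 1) = y} =
          (fun ω : ℕ → α => (Preorder.frestrictLe (π := fun _ => α) n ω, ω (n + 1))) ⁻¹'
            A ×ˢ {y} := by
        ext ω
        exact and_congr_left fun _ => (hA ω).symm
      have e2 : {ω : ℕ → α | Q ω ∧ ω n = x} = Preorder.frestrictLe (π := fun _ => α) n ⁻¹' A := by
        ext ω
        exact (hA ω).symm
      rw [e1, e2, mul_comm]
      exact h'.symm
    · intro h hh
      change (κ (h ⟨n, _⟩)).toMeasure {y} = κ x y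
      rw [PMF.toMeasure_apply_singleton _ _ (measurableSet_singleton y), hh.2]

/-! ### The growing tree -/

section chain

variable {θ : ℕ+ → ℝ}

/-- Grouping the vertices by last letter makes the weight multiplicative over vertices, so that
removing one divides out `lastWeight`. -/
theorem subtreeWeight_eq_prod (θ : ℕ+ → ℝ) (τ : Finset UlamHarris) :
    subtreeWeight θ τ = ∏ u ∈ τ, lastWeight θ u := by
  classical
  let s : Finset ℕ+ := τ.biUnion fun u => u.getLast?.toFinset
  have h1 : subtreeWeight θ τ = ∏ i ∈ s, θ i ^ (verticesOfType i τ).card := by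
    rw [subtreeWeight]
    refine finprod_eq_prod_of_mulSupport_subset _ fun i hi => ?_
    have : (verticesOfType i τ).Nonempty := by
      rw [Finset.nonempty_iff_ne_empty]
      intro h
      simp [h] at hi
    obtain ⟨u, hu⟩ := this
    obtain ⟨hu, v, rfl⟩ := Finset.mem_filter.1 hu
    simp only [s, Finset.coe_biUnion, Set.mem_iUnion]
    exact ⟨_, hu, by simp⟩
  have h2 : ∀ i, θ i ^ (verticesOfType i τ).card =
      ∏ u ∈ τ, if u.getLast? = some i then θ i else 1 := fun i => by
    rw [← Finset.prod_filter, Finset.prod_const, verticesOfType]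
    congr 2
    ext u
    simp [List.getLast?_eq_some_iff]
  rw [h1, Finset.prod_congr rfl fun i _ => h2 i, Finset.prod_comm]
  refine Finset.prod_congr rfl fun u hu => ?_
  rcases h : u.getLast? with _ | j
  · simp [lastWeight, h]
  · have hj : j ∈ s := Finset.mem_biUnion.2 ⟨u, hu, by simp [h]⟩
    simp only [Option.some.injEq, lastWeight, h, Option.elim_some]
    rw [Finset.prod_ite_eq s j θ, if_pos hj]

theorem subtreeWeight_erase (θ : ℕ+ → ℝ) {τ : Finset UlamHarris} {u : UlamHarris} (hu : u ∈ τ) :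
    subtreeWeight θ τ = lastWeight θ u * subtreeWeight θ (τ.erase u) := by
  rw [subtreeWeight_eq_prod, subtreeWeight_eq_prod, Finset.mul_prod_erase _ _ hu]

theorem lastWeight_nonneg (hθ : ∀ i, 0 ≤ θ i) (u : UlamHarris) : 0 ≤ lastWeight θ u := by
  rw [lastWeight]
  cases u.getLast? <;> simp [hθ]

theorem subtreeWeight_nonneg (hθ : ∀ i, 0 ≤ θ i) (τ : Finset UlamHarris) :
    0 ≤ subtreeWeight θ τ := by
  rw [subtreeWeight_eq_prod]
  exact Finset.prod_nonneg fun u _ => lastWeight_nonneg hθ u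

theorem lastWeight_pos_of_subtreeWeight_ne_zero (hθ : ∀ i, 0 ≤ θ i) {τ : Finset UlamHarris}
    (h : subtreeWeight θ τ ≠ 0) : ∀ u ∈ τ, 0 < lastWeight θ u := by
  rw [subtreeWeight_eq_prod, Finset.prod_ne_zero_iff] at h
  exact fun u hu => (lastWeight_nonneg hθ u).lt_of_ne' (h u hu)

open Classical in
/-- The law of the tree with `n` vertices, as a mass function on finite sets of words. -/
noncomputable def treeLaw (θ : ℕ+ → ℝ) (n : ℕ) (τ : Finset UlamHarris) : ENNReal :=
  if ParentClosed τ ∧ τ.card = n then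
    ENNReal.ofReal (subtreeWeight θ τ / treeWeight (fun j => θ j.succPNat) n) else 0

open Classical in
/-- The transition probabilities of the growing tree. -/
noncomputable def growthKernel (θ : ℕ+ → ℝ) (τ : Finset UlamHarris) : PMF (Finset UlamHarris) :=
  if h : ∑' u, ENNReal.ofReal (growthProb (fun j => θ j.succPNat) u τ) = 1 then
    PMF.map (fun u => insert u τ) ⟨fun u => ENNReal.ofReal (growthProb (fun j => θ j.succPNat) u τ),
      h ▸ ENNReal.summable.hasSum⟩
  -- Never used from a set of positive `treeLaw`, by `tsum_growthProb`.
  else PMF.pure ∅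

theorem of_treeLaw_ne_zero {n : ℕ} {τ : Finset UlamHarris} (h : treeLaw θ n τ ≠ 0) :
    ParentClosed τ ∧ τ.card = n ∧ subtreeWeight θ τ ≠ 0 := by
  rw [treeLaw] at h
  split_ifs at h with h'
  · refine ⟨h'.1, h'.2, fun h0 => h ?_⟩
    simp [h0]
  · exact absurd rfl h

theorem growthKernel_apply (hθ : ∀ i, 0 ≤ θ i) (hs : Summable fun j : ℕ => θ j.succPNat)
    (hpos : 0 < ∑' j : ℕ, θ j.succPNat) {n : ℕ} {x : Finset UlamHarris}
    (hx : treeLaw θ n x ≠ 0) (y : Finset UlamHarris) :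
    growthKernel θ x y = ∑' u, if y = insert u x then
      ENNReal.ofReal (growthProb (fun j => θ j.succPNat) u x) else 0 := by
  obtain ⟨hc, -, hw⟩ := of_treeLaw_ne_zero hx
  have h1 := tsum_growthProb hθ hs hpos x hc (lastWeight_pos_of_subtreeWeight_ne_zero hθ hw)
  rw [growthKernel, dif_pos h1]
  refine (PMF.map_apply _ _ _).trans (tsum_congr fun u => ?_)
  split_ifs <;> rfl

theorem sum_treeLaw_erase_mul (hθ : ∀ i, 0 ≤ θ i) (hs : Summable fun j : ℕ => θ j.succPNat)
    (hpos : 0 < ∑' j : ℕ, θ j.succPNat) (n : ℕ) (y : Finset UlamHarris) :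
    ∑ u ∈ y, treeLaw θ n (y.erase u) *
      ENNReal.ofReal (growthProb (fun j => θ j.succPNat) u (y.erase u)) =
      treeLaw θ (n + 1) y := by
  set t : ℕ → ℝ := fun j => θ j.succPNat with ht_def
  have ht : ∀ j, 0 ≤ t j := fun j => hθ _
  have hz := fun n => treeWeight_pos ht hpos n
  by_cases hy : ParentClosed y ∧ y.card = n + 1 ∧ subtreeWeight θ y ≠ 0
  · obtain ⟨hc, hn, hw⟩ := hy
    have hw' := lastWeight_pos_of_subtreeWeight_ne_zero hθ hw
    have hterm : ∀ u ∈ y, treeLaw θ n (y.erase u) * ENNReal.ofReal (growthProb t u (y.erase u)) =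
        ENNReal.ofReal (subtreeWeight θ y / treeWeight t n *
          (growthProb t u (y.erase u) / lastWeight θ u)) := fun u hu => by
      -- If `u` is not a leaf, `y.erase u` is no tree, but then the growth probability vanishes.
      by_cases h0 : growthProb t u (y.erase u) = 0
      · simp [h0]
      · rw [treeLaw, if_pos ⟨parentClosed_erase_of_growthProb_ne_zero hc h0, by
          rw [Finset.card_erase_of_mem hu, hn, Nat.add_sub_cancel]⟩,
          ← ENNReal.ofReal_mul (div_nonneg (subtreeWeight_nonneg hθ _) (hz n).le),
          subtreeWeight_erase θ hu]
        congr 1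
        have := (hw' u hu).ne'
        have := (hz n).ne'
        field_simp
    have hne : y.Nonempty := Finset.card_pos.1 (by omega)
    rw [Finset.sum_congr rfl hterm, ← ENNReal.ofReal_sum_of_nonneg, ← Finset.mul_sum,
      sum_growthProb_erase_div_lastWeight hθ hs hpos y hc (hc.nil_mem hne) hw', treeLaw,
      if_pos ⟨hc, hn⟩, hn, Nat.add_sub_cancel]
    · congr 1
      have := (hz n).ne'
      have := (hz (n + 1)).ne'
      change subtreeWeight θ y / treeWeight t n * (treeWeight t n / treeWeight t (n + 1)) =
        subtreeWeight θ y / treeWeight t (n + 1)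
      field_simp
    · intro u hu
      exact mul_nonneg (div_nonneg (subtreeWeight_nonneg hθ _) (hz n).le)
        (div_nonneg (growthProb_nonneg ht hs hpos _ _) (hw' u hu).le)
  · have h0 : treeLaw θ (n + 1) y = 0 := by
      by_contra h
      exact hy (of_treeLaw_ne_zero h)
    rw [h0]
    refine Finset.sum_eq_zero fun u hu => ?_
    by_contra h
    obtain ⟨h1, h2⟩ := mul_ne_zero_iff.1 h
    obtain ⟨hc, hn, hw⟩ := of_treeLaw_ne_zero h1
    obtain ⟨-, h4, h5⟩ := growthProb_ne_zero hθ hs hc (u := u) fun h => h2 (by simp [ht_def, h])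
    rw [Finset.insert_erase hu] at h4
    refine hy ⟨h4, ?_, ?_⟩
    · rw [← hn, Finset.card_erase_add_one hu]
    · rw [subtreeWeight_erase θ hu]
      exact mul_ne_zero h5.ne' hw

theorem tsum_treeLaw_mul_growthKernel (hθ : ∀ i, 0 ≤ θ i)
    (hs : Summable fun j : ℕ => θ j.succPNat) (hpos : 0 < ∑' j : ℕ, θ j.succPNat) (n : ℕ)
    (y : Finset UlamHarris) :
    ∑' x, treeLaw θ n x * growthKernel θ x y = treeLaw θ (n + 1) y := by
  set t : ℕ → ℝ := fun j => θ j.succPNat with ht_def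
  have h1 : ∀ x, treeLaw θ n x * growthKernel θ x y =
      ∑' u, if y = insert u x then treeLaw θ n x * ENNReal.ofReal (growthProb t u x) else 0 := by
    intro x
    by_cases hx : treeLaw θ n x = 0
    · simp [hx]
    · rw [growthKernel_apply hθ hs hpos hx, ← ENNReal.tsum_mul_left]
      exact tsum_congr fun u => mul_ite_zero _ _ _
  have h2 : ∀ u, (∑' x, if y = insert u x then
      treeLaw θ n x * ENNReal.ofReal (growthProb t u x) else 0) =
      if u ∈ y then treeLaw θ n (y.erase u) * ENNReal.ofReal (growthProb t u (y.erase u))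
        else 0 := by
    intro u
    split_ifs with hu
    · rw [tsum_eq_single (y.erase u), if_pos (Finset.insert_erase hu).symm]
      intro x hx
      split_ifs with hxy
      · by_contra h
        obtain ⟨h1, h2⟩ := mul_ne_zero_iff.1 h
        obtain ⟨hux, -, -⟩ := growthProb_ne_zero hθ hs (of_treeLaw_ne_zero h1).1 (u := u)
          fun h => h2 (by simp [ht_def, h])
        exact hx (by rw [hxy, Finset.erase_insert hux])
      · rfl
    · rw [ENNReal.tsum_eq_zero]
      intro x
      rw [if_neg]
      rintro rfl
      exact hu (Finset.mem_insert_self _ _)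
  rw [tsum_congr h1, ENNReal.tsum_comm, tsum_congr h2, tsum_eq_sum (s := y)
    fun u hu => if_neg hu, ← sum_treeLaw_erase_mul hθ hs hpos]
  exact Finset.sum_congr rfl fun u hu => if_pos hu

theorem ssubset_of_growthKernel_ne_zero (hθ : ∀ i, 0 ≤ θ i)
    (hs : Summable fun j : ℕ => θ j.succPNat) (hpos : 0 < ∑' j : ℕ, θ j.succPNat) {n : ℕ}
    {x y : Finset UlamHarris} (hx : treeLaw θ n x ≠ 0) (hy : growthKernel θ x y ≠ 0) : x ⊂ y := by
  rw [growthKernel_apply hθ hs hpos hx, Ne, ENNReal.tsum_eq_zero] at hy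
  push Not at hy
  obtain ⟨u, hu⟩ := hy
  split_ifs at hu with hxy
  · obtain ⟨hux, -, -⟩ := growthProb_ne_zero hθ hs (of_treeLaw_ne_zero hx).1 (u := u)
      fun h => hu (by simp [h])
    rw [hxy]
    exact Finset.ssubset_insert hux
  · exact absurd rfl hu

theorem treeLaw_zero (τ : Finset UlamHarris) : treeLaw θ 0 τ = if τ = ∅ then 1 else 0 := by
  rw [treeLaw]
  split_ifs with h1 h2 h2
  · simp [h2, subtreeWeight_eq_prod]
  · exact absurd (Finset.card_eq_zero.1 h1.2) h2
  · subst h2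
    exact absurd ⟨fun u i hu => by simp at hu, rfl⟩ h1
  · rfl

/-! ### Identification of the normalising constants and of the laws. -/

instance RootedSubtree.instCountable (n : ℕ) : Countable (RootedSubtree n) :=
  Function.Injective.countable (f := RootedSubtree.verts) fun _ _ h => RootedSubtree.ext h

instance RootedSubtree.instDiscreteMeasurableSpace (n : ℕ) :
    DiscreteMeasurableSpace (RootedSubtree n) := ⟨fun _ => trivial⟩

/-- No enumeration of trees is needed: `treeLaw` has total mass one, which forces its normalising
constant to be the partition function. -/
theorem subtreePartition_eq (hθ : ∀ i, 0 ≤ θ i) (hpos : 0 < ∑' j : ℕ, θ j.succPNat) {n : ℕ}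
    (hn : n ≠ 0) (h : ∑' τ, treeLaw θ n τ = 1) :
    subtreePartition θ n = ENNReal.ofReal (treeWeight (fun j => θ j.succPNat) n) := by
  have hz := treeWeight_pos (t := fun j => θ j.succPNat) (fun j => hθ _) hpos n
  have hinj : Function.Injective (RootedSubtree.verts (n := n)) :=
    fun _ _ h => RootedSubtree.ext h
  rw [← hinj.tsum_eq] at h
  · have h' : ∀ τ : RootedSubtree n, treeLaw θ n τ.verts =
        ENNReal.ofReal (subtreeWeight θ τ.verts) *
          (ENNReal.ofReal (treeWeight (fun j => θ j.succPNat) n))⁻¹ := fun τ => by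
      rw [treeLaw, if_pos ⟨τ.isRootedSubtree.2, τ.card_verts⟩, ENNReal.ofReal_div_of_pos hz]
      rfl
    rw [tsum_congr h', ENNReal.tsum_mul_right] at h
    exact (ENNReal.eq_inv_of_mul_eq_one_left h).trans (inv_inv _)
  · intro τ hτ
    obtain ⟨h1, h2, -⟩ := of_treeLaw_ne_zero hτ
    exact ⟨⟨τ, ⟨Finset.card_pos.1 (by omega), h1⟩, h2⟩, rfl⟩

theorem subtreeMeasure_singleton (hθ : ∀ i, 0 ≤ θ i) (hpos : 0 < ∑' j : ℕ, θ j.succPNat) {n : ℕ}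
    (hn : n ≠ 0) (h : ∑' τ, treeLaw θ n τ = 1) (τ : RootedSubtree n) :
    subtreeMeasure θ n {τ} = treeLaw θ n τ.verts := by
  classical
  have hz := treeWeight_pos (t := fun j => θ j.succPNat) (fun j => hθ _) hpos n
  rw [subtreeMeasure, Measure.sum_apply _ (measurableSet_singleton τ), tsum_eq_single τ,
    subtreePartition_eq hθ hpos hn h, treeLaw, if_pos ⟨τ.isRootedSubtree.2, τ.card_verts⟩,
    ENNReal.ofReal_div_of_pos hz]
  · simp
  · intro σ hσ
    simp [hσ]

end chain

/-! ### Construction of the increasing Markov process. -/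

theorem theorem3 (θ : ℕ+ → ℝ) (hθ : ∀ i, 0 ≤ θ i) (hsum : Summable θ)
    (hpos : 0 < ∑' i, θ i) :
    ∃ (Ω : Type) (_ : MeasurableSpace Ω) (P : Measure Ω) (_ : IsProbabilityMeasure P)
      (T : (n : ℕ+) → Ω → RootedSubtree n),
      (∀ n, Measurable (T n)) ∧
      (∀ n, P.map (T n) = subtreeMeasure θ n) ∧
      IsMarkovProcess P T ∧
      ∀ (n : ℕ+) (ω : Ω), (T n ω).verts ⊂ (T (n + 1) ω).verts := by
  classical
  have hs : Summable fun j : ℕ => θ j.succPNat := Equiv.pnatEquivNat.symm.summable_iff.2 hsum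
  replace hpos : 0 < ∑' j : ℕ, θ j.succPNat := by
    rwa [← Equiv.pnatEquivNat.symm.tsum_eq] at hpos
  let _ : MeasurableSpace (Finset UlamHarris) := ⊤
  have : DiscreteMeasurableSpace (Finset UlamHarris) := ⟨fun _ => trivial⟩
  -- Starting from the empty set at time `0` makes time equal to the number of vertices.
  obtain ⟨P, hP, h0, hstep⟩ := exists_markovChain ∅ (growthKernel θ)
  have htrans : ∀ n x y, P {ω | ω n = x ∧ ω (n + 1) = y} =
      P {ω | ω n = x} * growthKernel θ x y := fun n x y => by
    simpa using hstep n (fun _ => True) (fun _ _ _ _ => trivial) x y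
  have hcoord : ∀ n x, MeasurableSet {ω : ℕ → Finset UlamHarris | ω n = x} := fun n x =>
    (measurable_pi_apply n : Measurable fun ω : ℕ → Finset UlamHarris => ω n)
      (measurableSet_singleton x)
  have hdecomp : ∀ n (A : Set (ℕ → Finset UlamHarris)), MeasurableSet A →
      P A = ∑' x, P {ω | ω n = x ∧ ω ∈ A} := fun n A hA => by
    rw [← measure_iUnion]
    · congr 1
      ext ω
      simp
    · intro x y hxy
      rw [Function.onFun, Set.disjoint_left]
      rintro ω ⟨h1, -⟩ ⟨h2, -⟩
      exact hxy (h1.symm.trans h2)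
    · intro x
      exact (hcoord n x).inter hA
  have hlaw : ∀ n x, P {ω | ω n = x} = treeLaw θ n x := by
    intro n
    induction n with
    | zero =>
      intro x
      rw [treeLaw_zero]
      split_ifs with hx
      · rw [hx, h0]
      · refine measure_mono_null (t := {ω | ω 0 = ∅}ᶜ) (fun ω hω h => hx ?_)
          ((prob_compl_eq_zero_iff (hcoord 0 ∅)).2 h0)
        exact (Eq.symm hω).trans h
    | succ n ih =>
      intro y
      rw [hdecomp n _ (hcoord (n + 1) y),
        ← tsum_treeLaw_mul_growthKernel hθ hs hpos]
      exact tsum_congr fun x => by rw [← ih]; exact htrans n x y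
  -- The total mass is inherited from `P`, since `treeLaw θ n` is the law of a coordinate.
  have hone : ∀ n, ∑' τ, treeLaw θ n τ = 1 := fun n => by
    have := hdecomp n Set.univ MeasurableSet.univ
    simp only [measure_univ, Set.mem_univ, and_true, hlaw] at this
    exact this.symm
  let R : ℕ → Finset UlamHarris → Finset UlamHarris → Prop := fun n x y =>
    (ParentClosed x ∧ x.card = n) ∧ x ⊂ y
  let good : Set (ℕ → Finset UlamHarris) := {ω | ∀ n, R n (ω n) (ω (n + 1))}
  have hgood_meas : MeasurableSet good := by
    have : good = ⋂ n, (fun ω => (ω n, ω (n + 1))) ⁻¹' {p | R n p.1 p.2} := by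
      ext ω; simp [good]
    rw [this]
    exact MeasurableSet.iInter fun n => (by fun_prop : Measurable fun ω : ℕ → Finset UlamHarris =>
      (ω n, ω (n + 1))) (Set.to_countable _).measurableSet
  have hgood : ∀ᵐ ω ∂P, ω ∈ good := by
    refine ae_all_iff.2 fun n => ?_
    rw [ae_iff]
    refine measure_mono_null (t := ⋃ (x) (y), {ω | ¬ R n x y ∧ ω n = x ∧ ω (n + 1) = y})
      (fun ω hω => ?_) (measure_iUnion_null fun x => measure_iUnion_null fun y => ?_)
    · simp only [Set.mem_iUnion]
      exact ⟨ω n, ω (n + 1), hω, rfl, rfl⟩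
    · by_cases hR : R n x y
      · simp [hR]
      · simp only [hR, not_false_eq_true, true_and]
        rw [htrans, hlaw]
        by_contra hne
        obtain ⟨h1, h2⟩ := mul_ne_zero_iff.1 hne
        obtain ⟨h3, h4, -⟩ := of_treeLaw_ne_zero h1
        exact hR ⟨⟨h3, h4⟩, ssubset_of_growthKernel_ne_zero hθ hs hpos h1 h2⟩
  obtain ⟨ω₀, hω₀⟩ := hgood.exists
  -- Replacing the null set of bad trajectories by one fixed good trajectory makes the inclusions
  -- hold surely, without changing any law.
  let g : (ℕ → Finset UlamHarris) → ℕ → Finset UlamHarris := fun ω => if ω ∈ good then ω else ω₀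
  have hg : ∀ ω, g ω ∈ good := fun ω => by
    by_cases h : ω ∈ good <;> simp [g, h, hω₀]
  have hg_meas : Measurable g := Measurable.ite hgood_meas measurable_id measurable_const
  have hg_ae : ∀ᵐ ω ∂P, g ω = ω := hgood.mono fun ω h => by simp [g, h]
  let T : (n : ℕ+) → (ℕ → Finset UlamHarris) → RootedSubtree n := fun n ω =>
    ⟨g ω n, ⟨Finset.card_pos.1 (by rw [(hg ω n).1.2]; exact n.pos), (hg ω n).1.1⟩, (hg ω n).1.2⟩
  have hT : ∀ (n : ℕ+) ω (τ : RootedSubtree n), T n ω = τ ↔ g ω n = τ.verts := fun n ω τ =>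
    RootedSubtree.ext_iff
  have hT_ae : ∀ᵐ ω ∂P, ∀ (n : ℕ+) (τ : RootedSubtree n), T n ω = τ ↔ ω n = τ.verts :=
    hg_ae.mono fun ω h n τ => by rw [hT, h]
  have hT_meas : ∀ n, Measurable (T n) := fun n => by
    refine measurable_to_countable' fun τ => ?_
    have : T n ⁻¹' {τ} = g ⁻¹' {ω | ω n = τ.verts} := by
      ext ω
      exact hT n ω τ
    rw [this]
    exact hg_meas (hcoord _ _)
  refine ⟨ℕ → Finset UlamHarris, inferInstance, P, hP, T, hT_meas, fun n => ?_, ?_, fun n ω => ?_⟩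
  · refine Measure.ext_of_singleton fun τ => ?_
    rw [Measure.map_apply (hT_meas n) (measurableSet_singleton τ),
      subtreeMeasure_singleton hθ hpos n.ne_zero (hone n), ← hlaw]
    exact measure_congr (hT_ae.mono fun ω h => propext (h n τ))
  · intro n x hne
    have hTs : ∀ k, MeasurableSet {ω | T k ω = x k} := fun k =>
      hT_meas k (measurableSet_singleton _)
    have hA : MeasurableSet {ω | ∀ k ≤ n, T k ω = x k} := by
      have : {ω | ∀ k ≤ n, T k ω = x k} = ⋂ (k) (_ : k ≤ n), {ω | T k ω = x k} := by
        ext ω; simp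
      rw [this]
      exact MeasurableSet.iInter fun k => MeasurableSet.iInter fun _ => hTs k
    have hle : {ω | ∀ k ≤ n, T k ω = x k} ⊆ {ω | T n ω = x n} := fun ω hω => hω n le_rfl
    have hne' : P {ω | T n ω = x n} ≠ 0 := fun h => hne (measure_mono_null hle h)
    have e1 : P ({ω | T n ω = x n} ∩ {ω | T (n + 1) ω = x (n + 1)}) =
        P {ω | T n ω = x n} * growthKernel θ (x n).verts (x (n + 1)).verts := by
      rw [measure_congr (s := {ω | T n ω = x n}) (t := {ω | ω n = (x n).verts})
        (hT_ae.mono fun ω h => propext (h n _)), ← htrans]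
      exact measure_congr (hT_ae.mono fun ω h => propext (and_congr (h n _) (h (n + 1) _)))
    have e2 : P ({ω | ∀ k ≤ n, T k ω = x k} ∩ {ω | T (n + 1) ω = x (n + 1)}) =
        P {ω | ∀ k ≤ n, T k ω = x k} * growthKernel θ (x n).verts (x (n + 1)).verts := by
      -- Coordinate `0` is absent from this event; this is why the chain property was stated for
      -- every `Q` depending on coordinates up to `n`, not just for full histories.
      have hpast : ∀ᵐ ω ∂P, (∀ k ≤ n, T k ω = x k) ↔
          ((∀ k : ℕ+, k ≤ n → ω k = (x k).verts) ∧ ω n = (x n).verts) :=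
        hT_ae.mono fun ω h =>
          ⟨fun hω => ⟨fun k hk => (h k _).1 (hω k hk), (h n _).1 (hω n le_rfl)⟩,
            fun hω k hk => (h k _).2 (hω.1 k hk)⟩
      rw [measure_congr (s := {ω | ∀ k ≤ n, T k ω = x k})
        (t := {ω | (∀ k : ℕ+, k ≤ n → ω k = (x k).verts) ∧ ω n = (x n).verts})
        (hpast.mono fun ω h => propext h), ← hstep n _ ?_]
      · refine measure_congr ?_
        filter_upwards [hpast, hT_ae] with ω h h'
        exact propext (and_congr h (h' (n + 1) _))
      · intro ω ω' hωω' hω k hk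
        rw [← hωω' k hk, hω k hk]
    rw [cond_apply hA, cond_apply (hTs n), e1, e2, ← mul_assoc, ← mul_assoc,
      ENNReal.inv_mul_cancel hne (measure_ne_top _ _),
      ENNReal.inv_mul_cancel hne' (measure_ne_top _ _)]
  · exact (hg ω n).2
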